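/- Let $C_0,C_1,\rho,\sigma,\mu>0$, $r_0\ge 1$ and $\varphi\in\mathbb R$. Let $\mathcal M=\mathcal M(C_0,C_1,\rho,\sigma,\mu,r_0)$ be the set of entire functions $\psi$ such that $$|\psi(z)|\le C_0e^{\sigma|z|^\rho}\ \text{ for } |z|\ge r_0,\qquad |\psi(z)-1|\le C_1|z|^{-\mu}\ \text{ for } \arg z=\varphi,\ |z|\ge r_0 .$$ For $\delta\in(0,1)$ let $p=p(\delta)$ be the least positive integer with $\delta(p+1)-\rho\ge\mu$. Let $W=1!\,2!\cdots p!$ be the determinant of the Vandermonde matrix $(k^{j-1})_{k,j=1}^{p+1}$, let $W_{kj}$ be the cofactor of the entry in row $k$ and column $j$, and put $$A_p=\frac1W\sum_{k=1}^{p+1}\sum_{j=1}^{p+1}|W_{kj}|\,k^{-\mu},\qquad C(\delta)=20A_pC_1,\qquad C_2=\frac{2\sigma(p+1)(2e)^\rho}{p+1-\rho},$$ $$r_1=\max\Big(r_0,\ (2C_1)^{1/\mu},\ \tfrac1{2e}\big(\tfrac{\max(0,\ln(2C_0))}{\sigma}\big)^{1/\rho}\Big),$$ $$r_2=\max\Big(r_1,\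 \big(\tfrac{(p+1)^2}{p}\big)^{1/\delta},\ \big(\tfrac{C_2(p+1)^{p+1}}{\ln 2}\big)^{1/\mu}\Big),\qquad r_3=\max\Big(r_2,\ \big(6C_2(p+1)^{p+1}\big)^{1/\mu}\Big),$$ $$r_4=\max\Big(r_0^{1/(1-\delta)},\ (36C_1A_p)^{1/(\mu(1-\delta))}\Big),\qquad r_5=\Big(2(p+1)^{p+1}\tfrac{C_2}{C_1}\Big)^{1/(\mu\delta)},$$ $$R_*(\delta)=\max(r_1,r_2,r_3,r_4,r_5),$$ and, for $\varepsilon>0$ and $0<\delta_1<\delta$, $$R_0=\max\Big(R_*(\delta),\ R_*(\delta_1),\ \big(C(\delta_1)/\varepsilon\big)^{1/(\mu(\delta-\delta_1))}\Big).$$ Let $\psi_1,\psi_2\in\mathcal M$ (with the same ray $\arg z=\varphi$) have the same zeros, with multiplicities, in the open disc $B(0,R)$, so that $\psi_2/\psi_1$ extends analytically to $B(0,R)$. Then for all $\delta\in(0,1)$, $\varepsilon>0$ and $\delta_1\in(0,\delta)$: 1. if $R\ge R_0$, then $$\left|\frac{\psi_2(z)}{\psi_1(z)}-1\right|<\frac{\varepsilon}{R^{\mu(1-\delta)}}\qquad\text{for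 all } z\in B(0,R^{1-\delta});$$ 2. if $R\ge R_*(\delta)$, then $$\left|\frac{\psi_2(z)}{\psi_1(z)}-1\right|\le\frac{C(\delta)}{R^{\mu(1-\delta)}}\qquad\text{for all } z\in B(0,R^{1-\delta}).$$ In particular (take $\delta_1=\delta/2$) $R_0$ depends only on $\delta,\varepsilon$ and $C_0,C_1,\rho,\sigma,\mu,r_0$, and not on $\psi_1,\psi_2$ or $\varphi$. -/

import Mathlib

/-- The six real parameters of the class `𝓜(C₀, C₁, ρ, σ, μ, r₀)`. -/
structure ClassParams where
  C₀ : ℝ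
  C₁ : ℝ
  ρ : ℝ
  σ : ℝ
  μ : ℝ
  r₀ : ℝ

/-- All parameters are positive and `r₀ ≥ 1`. -/
structure ClassParams.Admissible (P : ClassParams) : Prop where
  C₀_pos : 0 < P.C₀
  C₁_pos : 0 < P.C₁
  ρ_pos : 0 < P.ρ
  σ_pos : 0 < P.σ
  μ_pos : 0 < P.μ
  one_le_r₀ : 1 ≤ P.r₀

/-- `ψ` belongs to the class `𝓜(C₀, C₁, ρ, σ, μ, r₀)` with respect to the ray `arg z = φ`. -/
structure ClassParams.Mem (P : ClassParams) (φ : ℝ) (ψ : ℂ → ℂ) : Prop where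
  entire : Differentiable ℂ ψ
  growth : ∀ z : ℂ, P.r₀ ≤ ‖z‖ → ‖ψ z‖ ≤ P.C₀ * Real.exp (P.σ * ‖z‖ ^ P.ρ)
  ray : ∀ t : ℝ, P.r₀ ≤ t →
    ‖ψ ((t : ℂ) * Complex.exp ((φ : ℂ) * Complex.I)) - 1‖ ≤ P.C₁ / t ^ P.μ

/-- The zeros of `ψ₁` and `ψ₂` in the open disc `B(0, R)` coincide, with multiplicities. -/
def SameZeros (ψ₁ ψ₂ : ℂ → ℂ) (R : ℝ) : Prop :=
  ∀ z ∈ Metric.ball (0 : ℂ) R, analyticOrderAt ψ₁ z = analyticOrderAt ψ₂ z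

namespace ClassParams

noncomputable section

/-- The least `p ∈ {1, 2, …}` with `δ (p + 1) - ρ ≥ μ`. -/
def p (P : ClassParams) (δ : ℝ) : ℕ :=
  sInf {n : ℕ | 1 ≤ n ∧ P.μ ≤ δ * ((n : ℝ) + 1) - P.ρ}

/-- The Vandermonde matrix with the nodes `1, 2, …, n + 1`: row `k`, column `j` (both counted
from `0`) holds `(k + 1) ^ j`. -/
def vandermondeMatrix (n : ℕ) : Matrix (Fin (n + 1)) (Fin (n + 1)) ℝ :=
  Matrix.vandermonde fun k => (k : ℝ) + 1

/-- `A_n = W⁻¹ ∑_{k,j} |W_{kj}| k ^ (-μ)`, where `W` is the Vandermonde determinant with nodes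
`1, …, n + 1` and `W_{kj}` is the cofactor of its entry in row `k` and column `j`, that is, the
entry `(j, k)` of the adjugate matrix. -/
def A (P : ClassParams) (n : ℕ) : ℝ :=
  (∑ k : Fin (n + 1), ∑ j : Fin (n + 1),
    |(vandermondeMatrix n).adjugate j k| * ((k : ℝ) + 1) ^ (-P.μ)) / (vandermondeMatrix n).det

/-- `C(δ) = 20 A_p C₁`. -/
def C (P : ClassParams) (δ : ℝ) : ℝ := 20 * P.A (P.p δ) * P.C₁

/-- `C₂ = 2 σ (p + 1) (2 e) ^ ρ / (p + 1 - ρ)`. -/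
def C₂ (P : ClassParams) (δ : ℝ) : ℝ :=
  2 * P.σ * ((P.p δ : ℝ) + 1) * (2 * Real.exp 1) ^ P.ρ / ((P.p δ : ℝ) + 1 - P.ρ)

/-- The positive part of `ln (2 C₀)` is taken: if `2 C₀ ≤ 1`, the third term is `0`. -/
def r₁ (P : ClassParams) : ℝ :=
  max P.r₀ (max ((2 * P.C₁) ^ (1 / P.μ))
    (1 / (2 * Real.exp 1) * (max 0 (Real.log (2 * P.C₀)) / P.σ) ^ (1 / P.ρ)))

def r₂ (P : ClassParams) (δ : ℝ) : ℝ :=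
  max P.r₁ (max ((((P.p δ : ℝ) + 1) * ((P.p δ : ℝ) + 1) / (P.p δ : ℝ)) ^ (1 / δ))
    ((P.C₂ δ * ((P.p δ : ℝ) + 1) ^ (P.p δ + 1) / Real.log 2) ^ (1 / P.μ)))

def r₃ (P : ClassParams) (δ : ℝ) : ℝ :=
  max (P.r₂ δ) ((6 * P.C₂ δ * ((P.p δ : ℝ) + 1) ^ (P.p δ + 1)) ^ (1 / P.μ))

/-- The condition `R ≥ r₄` includes `R ^ (1 - δ) ≥ r₀`. -/
def r₄ (P : ClassParams) (δ : ℝ) : ℝ :=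
  max (P.r₀ ^ (1 / (1 - δ))) ((36 * P.C₁ * P.A (P.p δ)) ^ (1 / (P.μ * (1 - δ))))

def r₅ (P : ClassParams) (δ : ℝ) : ℝ :=
  (2 * ((P.p δ : ℝ) + 1) ^ (P.p δ + 1) * (P.C₂ δ / P.C₁)) ^ (1 / (P.μ * δ))

/-- The threshold `max (r₁, …, r₅)` for the estimate with the constant `C(δ)`. -/
def threshold (P : ClassParams) (δ : ℝ) : ℝ :=
  max P.r₁ (max (P.r₂ δ) (max (P.r₃ δ) (max (P.r₄ δ) (P.r₅ δ))))

/-- `R'(ε, δ)`, with the auxiliary number `δ₁ ∈ (0, δ)`. -/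
def R' (P : ClassParams) (δ δ₁ ε : ℝ) : ℝ :=
  max (P.threshold δ₁) ((P.C δ₁ / ε) ^ (1 / (P.μ * (δ - δ₁))))

/-- The threshold `R₀` for the estimate with an arbitrary `ε > 0`. -/
def R₀ (P : ClassParams) (δ δ₁ ε : ℝ) : ℝ :=
  max (P.threshold δ) (P.R' δ δ₁ ε)

end

end ClassParams

/-!
The zeros of `ψ₁` and `ψ₂` in `B(0, R)` are divided out: `ψᵢ = Q gᵢ` with the same polynomial `Q` and
entire `gᵢ` without zeros in `B(0, R)`, and the ratio is `q = g₂ / g₁` there. Put `r = R ^ (1 - δ)`,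
`x = C₁ / r ^ μ`, and rescale `z = r e ^ (iφ) s`. A branch `h` of `log q` is compared with its
interpolating polynomial of degree at most `p` at the nodes `s = 1, …, p + 1`, which lie on the ray.

* On the ray `q` is close to `1`, so `h` can be normalised to be the principal logarithm on the whole
  segment of nodes, and then `|h(k)| ≤ 3.1 x k ^ (-μ)`. The Lagrange basis polynomials have the
  normalised cofactors of the Vandermonde matrix as coefficients, so the interpolating polynomial is
  at most `3.1 A x` on the unit disc (`sum_norm_lagrangeWeight_le`).
* The interpolation error of `h` is at most `8 A x`. Indeed `log gᵢ` is, up to terms with negligible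
  interpolation error, the sum of `log (1 - z / a)` over the zeros `|a| ≥ R` of `ψᵢ`, and each of
  these logarithms has interpolation error `O((p + 2) ((p + 1) r / |a|) ^ (p + 1))`
  (`norm_interpError_log_le`). The bound for the number of zeros in a disc
  (`ClassParams.Mem.sum_multiplicity_le`) and summation by parts give `∑ |a| ^ (-p - 1) ≤
  C₂ R ^ (ρ - p - 1)`, which the threshold `r₅` compares with `x`. It matters that the error of the
  whole logarithm is estimated. Estimating its Taylor polynomial of degree `p` and the remainder
  separately would feed the remainder into the interpolation formula without the weight `k ^ (-μ)`,
  and the constant `A` does not cover this loss in general.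

No Hadamard factorisation is needed. In the disc of radius `T` the zeros are reflected to its outside
by Blaschke factors, the logarithm of the remaining function is `O(T ^ ρ)` by the Borel–Carathéodory
theorem, and since `p + 1 > ρ` its interpolation error and that of the reflected factors tend to `0`
as `T → ∞` (`ClassParams.Mem.norm_interpError_log_le`).

Altogether `|h| ≤ 11.1 A x` on the unit disc. With `A x ≤ 1 / 36` from `r₄`, this gives
`|q - 1| < 20 A x`. The inequality is strict, so the first part follows from the second one
with `δ₁` in place of `δ`.
-/

section

open Complex Metric Filter Topology

/-! ### Polynomial interpolation at the nodes `1, …, p + 1` -/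

/-- The value at `s` of the Lagrange basis polynomial of the node `k + 1` among the nodes
`1, …, p + 1`, expanded in powers of `s`: its coefficients are the normalised cofactors of the
Vandermonde matrix. -/
noncomputable def lagrangeWeight (p : ℕ) (k : Fin (p + 1)) (s : ℂ) : ℂ :=
  ∑ j : Fin (p + 1), s ^ (j : ℕ) *
    (((ClassParams.vandermondeMatrix p).adjugate j k /
      (ClassParams.vandermondeMatrix p).det : ℝ) : ℂ)

/-- The error at `s` of the interpolation of `F` by a polynomial of degree at most `p` at the nodes
`1, …, p + 1`. -/
noncomputable def interpError (p : ℕ) (F : ℂ → ℂ) (s : ℂ) : ℂ :=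
  F s - ∑ k : Fin (p + 1), lagrangeWeight p k s * F ((k : ℂ) + 1)

/-- The monic polynomial with simple zeros at the nodes `1, …, p + 1`. -/
noncomputable def nodal (p : ℕ) (s : ℂ) : ℂ := ∏ k : Fin (p + 1), (s - ((k : ℂ) + 1))

theorem det_vandermondeMatrix_pos (p : ℕ) : 0 < (ClassParams.vandermondeMatrix p).det := by
  rw [ClassParams.vandermondeMatrix, Matrix.det_vandermonde]
  refine Finset.prod_pos fun i _ => Finset.prod_pos fun j hj => ?_
  have h : i < j := by simpa using hj
  have h' : ((i : ℕ) : ℝ) < ((j : ℕ) : ℝ) := by exact_mod_cast h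
  linarith

theorem sum_lagrangeWeight_mul_pow (p : ℕ) (s : ℂ) (i : Fin (p + 1)) :
    ∑ k : Fin (p + 1), lagrangeWeight p k s * ((k : ℂ) + 1) ^ (i : ℕ) = s ^ (i : ℕ) := by
  set V := ClassParams.vandermondeMatrix p with hV
  have hd : V.det ≠ 0 := (det_vandermondeMatrix_pos p).ne'
  have key : ∀ j : Fin (p + 1), ∑ k : Fin (p + 1), V.adjugate j k / V.det * ((k : ℝ) + 1) ^ (i : ℕ)
      = if j = i then 1 else 0 := by
    intro j
    have h := congrFun (congrFun (Matrix.adjugate_mul V) j) i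
    rw [Matrix.mul_apply] at h
    have h2 : ∀ k : Fin (p + 1), V k i = ((k : ℝ) + 1) ^ (i : ℕ) := fun k => by
      simp [hV, ClassParams.vandermondeMatrix, Matrix.vandermonde_apply]
    simp only [h2, Matrix.smul_apply, Matrix.one_apply, smul_eq_mul] at h
    calc _ = (∑ k : Fin (p + 1), V.adjugate j k * ((k : ℝ) + 1) ^ (i : ℕ)) / V.det := by
          rw [Finset.sum_div]; exact Finset.sum_congr rfl fun k _ => by ring
      _ = _ := by rw [h]; split_ifs <;> field_simp
  have key' : ∀ j : Fin (p + 1), ∑ k : Fin (p + 1),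
      ((V.adjugate j k / V.det : ℝ) : ℂ) * ((k : ℂ) + 1) ^ (i : ℕ) = if j = i then 1 else 0 := by
    intro j
    have := congrArg (fun x : ℝ => (x : ℂ)) (key j)
    push_cast at this
    push_cast
    rw [this]
    split_ifs <;> simp
  calc _ = ∑ k : Fin (p + 1), ∑ j : Fin (p + 1), s ^ (j : ℕ) *
        (((V.adjugate j k / V.det : ℝ) : ℂ) * ((k : ℂ) + 1) ^ (i : ℕ)) := by
        refine Finset.sum_congr rfl fun k _ => ?_
        rw [lagrangeWeight, Finset.sum_mul]
        exact Finset.sum_congr rfl fun j _ => by ring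
    _ = ∑ j : Fin (p + 1), s ^ (j : ℕ) * (if j = i then 1 else 0) := by
        rw [Finset.sum_comm]
        refine Finset.sum_congr rfl fun j _ => ?_
        rw [← Finset.mul_sum, key']
    _ = _ := by simp

theorem sum_lagrangeWeight_mul_eval {p : ℕ} {Q : Polynomial ℂ} (hQ : Q.natDegree ≤ p) (s : ℂ) :
    ∑ k : Fin (p + 1), lagrangeWeight p k s * Q.eval ((k : ℂ) + 1) = Q.eval s := by
  simp only [Polynomial.eval_eq_sum_range' (Nat.lt_succ_of_le hQ), Finset.mul_sum]
  rw [Finset.sum_comm]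
  refine Finset.sum_congr rfl fun j hj => ?_
  have := sum_lagrangeWeight_mul_pow p s ⟨j, by simpa using hj⟩
  rw [← this, Finset.mul_sum]
  exact Finset.sum_congr rfl fun k _ => by ring

theorem sum_lagrangeWeight (p : ℕ) (s : ℂ) : ∑ k : Fin (p + 1), lagrangeWeight p k s = 1 := by
  simpa using sum_lagrangeWeight_mul_pow p s 0

theorem interpError_congr {p : ℕ} {F G : ℂ → ℂ} {s : ℂ} {T : Set ℂ} (h : Set.EqOn F G T)
    (hs : s ∈ T) (hT : ∀ k : Fin (p + 1), (k : ℂ) + 1 ∈ T) :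
    interpError p F s = interpError p G s := by
  simp only [interpError, h hs, fun k : Fin (p + 1) => h (hT k)]

theorem interpError_add (p : ℕ) (F G : ℂ → ℂ) (s : ℂ) :
    interpError p (fun z => F z + G z) s = interpError p F s + interpError p G s := by
  simp only [interpError, mul_add, Finset.sum_add_distrib]; ring

theorem interpError_sub (p : ℕ) (F G : ℂ → ℂ) (s : ℂ) :
    interpError p (fun z => F z - G z) s = interpError p F s - interpError p G s := by
  simp only [interpError, mul_sub, Finset.sum_sub_distrib]; ring

theorem interpError_const_mul (p : ℕ) (c : ℂ) (F : ℂ → ℂ) (s : ℂ) :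
    interpError p (fun z => c * F z) s = c * interpError p F s := by
  simp only [interpError, mul_sub, Finset.mul_sum]
  congr 1
  exact Finset.sum_congr rfl fun k _ => by ring

theorem interpError_const (p : ℕ) (c s : ℂ) : interpError p (fun _ => c) s = 0 := by
  simp [interpError, ← Finset.sum_mul, sum_lagrangeWeight]

theorem interpError_sum {ι : Type*} (p : ℕ) (t : Finset ι) (F : ι → ℂ → ℂ) (s : ℂ) :
    interpError p (fun z => ∑ i ∈ t, F i z) s = ∑ i ∈ t, interpError p (F i) s := by
  simp only [interpError, Finset.mul_sum, Finset.sum_sub_distrib]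
  rw [Finset.sum_comm]

theorem interpError_id {p : ℕ} (hp : 1 ≤ p) (s : ℂ) : interpError p (fun z => z) s = 0 := by
  have := sum_lagrangeWeight_mul_pow p s ⟨1, by omega⟩
  simp only [pow_one] at this
  simp [interpError, this]

theorem norm_node (p : ℕ) (k : Fin (p + 1)) : ‖(k : ℂ) + 1‖ = (k : ℝ) + 1 := by
  have : ((k : ℂ) + 1) = (((k : ℝ) + 1 : ℝ) : ℂ) := by push_cast; rfl
  rw [this, Complex.norm_real, Real.norm_of_nonneg (by positivity)]

theorem node_le (p : ℕ) (k : Fin (p + 1)) : (k : ℝ) + 1 ≤ (p : ℝ) + 1 := by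
  have : ((k : ℕ) : ℝ) ≤ p := by exact_mod_cast Nat.lt_succ_iff.mp k.2
  linarith

/-- The interpolation error of the geometric kernel `1 / (1 - c z)` is explicit, `c = 0` included. -/
theorem interpError_inv_one_sub_mul {p : ℕ} {c s : ℂ} (hs : 1 - c * s ≠ 0)
    (hc : ∀ k : Fin (p + 1), 1 - c * ((k : ℂ) + 1) ≠ 0) :
    interpError p (fun z => (1 - c * z)⁻¹) s =
      c ^ (p + 1) * nodal p s / ((1 - c * s) * ∏ k : Fin (p + 1), (1 - c * ((k : ℂ) + 1))) := by
  classical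
  set D : ℂ := ∏ k : Fin (p + 1), (1 - c * ((k : ℂ) + 1)) with hD
  have hD0 : D ≠ 0 := Finset.prod_ne_zero_iff.mpr fun k _ => hc k
  -- The interpolating polynomial `Q` satisfies `(1 - c z) Q(z) = 1 - c ^ (p + 1) ω(z) / D`.
  obtain ⟨Q, hQd, hQ⟩ : ∃ Q : Polynomial ℂ, Q.natDegree ≤ p ∧
      ∀ z : ℂ, (1 - c * z) * Q.eval z = 1 - c ^ (p + 1) * nodal p z / D := by
    rcases eq_or_ne c 0 with rfl | hc0
    · exact ⟨1, by simp, fun z => by simp⟩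
    · set N : Polynomial ℂ := 1 - Polynomial.C (c ^ (p + 1) / D) *
        ∏ k : Fin (p + 1), (Polynomial.X - Polynomial.C ((k : ℂ) + 1)) with hN
      have hNe : ∀ z, N.eval z = 1 - c ^ (p + 1) * nodal p z / D := fun z => by
        simp [hN, nodal, Polynomial.eval_prod]; ring
      have hroot : N.IsRoot c⁻¹ := by
        rw [Polynomial.IsRoot, hNe]
        have : c ^ (p + 1) * nodal p c⁻¹ = D := by
          rw [nodal, hD]
          have h : c ^ (p + 1) = ∏ _k : Fin (p + 1), c := by simp
          rw [h, ← Finset.prod_mul_distrib]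
          refine Finset.prod_congr rfl fun k _ => ?_
          field_simp
        rw [this, div_self hD0, sub_self]
      obtain ⟨Q, hQ⟩ := Polynomial.dvd_iff_isRoot.mpr hroot
      have hNd : N.natDegree ≤ p + 1 := by
        rw [hN]
        refine (Polynomial.natDegree_sub_le _ _).trans ?_
        simp only [Polynomial.natDegree_one, zero_le, sup_of_le_right]
        refine (Polynomial.natDegree_C_mul_le _ _).trans ?_
        rw [Polynomial.natDegree_prod_of_monic _ _ fun k _ => Polynomial.monic_X_sub_C _]
        simp only [Polynomial.natDegree_X_sub_C, Finset.sum_const, Finset.card_univ,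
          Fintype.card_fin, smul_eq_mul, mul_one, le_refl]
      refine ⟨Polynomial.C (-c⁻¹) * Q, ?_, fun z => ?_⟩
      · refine (Polynomial.natDegree_C_mul_le _ _).trans ?_
        rcases eq_or_ne Q 0 with rfl | hQ0
        · simp
        · rw [hQ, Polynomial.natDegree_mul (Polynomial.X_sub_C_ne_zero _) hQ0,
            Polynomial.natDegree_X_sub_C] at hNd
          omega
      · rw [← hNe, hQ]
        simp only [Polynomial.eval_mul, Polynomial.eval_C, Polynomial.eval_sub, Polynomial.eval_X]
        field_simp
        ring
  have hnode : ∀ k : Fin (p + 1), (1 - c * ((k : ℂ) + 1))⁻¹ = Q.eval ((k : ℂ) + 1) := by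
    intro k
    have h0 : nodal p ((k : ℂ) + 1) = 0 :=
      Finset.prod_eq_zero (Finset.mem_univ k) (sub_self _)
    have := hQ ((k : ℂ) + 1)
    rw [h0, mul_zero, zero_div, sub_zero] at this
    exact (eq_inv_of_mul_eq_one_right this).symm
  have hQs : Q.eval s = (1 - c ^ (p + 1) * nodal p s / D) / (1 - c * s) := by
    rw [← hQ s]; field_simp
  simp only [interpError, hnode]
  rw [sum_lagrangeWeight_mul_eval hQd, hQs]
  field_simp
  ring

theorem norm_nodal_le (p : ℕ) {s : ℂ} (hs : ‖s‖ ≤ 1) :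
    ‖nodal p s‖ ≤ ((p + 2).factorial : ℝ) := by
  have h : ∀ k : Fin (p + 1), ‖s - ((k : ℂ) + 1)‖ ≤ (k : ℝ) + 2 := fun k => by
    have := norm_sub_le s ((k : ℂ) + 1)
    rw [norm_node] at this
    linarith
  rw [nodal, norm_prod]
  refine (Finset.prod_le_prod (fun _ _ => norm_nonneg _) fun k _ => h k).trans ?_
  rw [Fin.prod_univ_eq_prod_range (fun k : ℕ => (k : ℝ) + 2)]
  refine le_of_eq ?_
  have : ∀ m : ℕ, ∏ k ∈ Finset.range m, ((k : ℝ) + 2) = ((m + 1).factorial : ℝ) := by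
    intro m
    induction m with
    | zero => simp
    | succ m ih => rw [Finset.prod_range_succ, ih, Nat.factorial_succ (m + 1)]; push_cast; ring
  exact this _

/-! ### The constant `A` -/

theorem norm_lagrangeWeight_le {p : ℕ} (k : Fin (p + 1)) {s : ℂ} (hs : ‖s‖ ≤ 1) :
    ‖lagrangeWeight p k s‖ ≤ (∑ j : Fin (p + 1),
      |(ClassParams.vandermondeMatrix p).adjugate j k|) / (ClassParams.vandermondeMatrix p).det := by
  rw [Finset.sum_div]
  refine (norm_sum_le _ _).trans (Finset.sum_le_sum fun j _ => ?_)
  rw [norm_mul, norm_pow, Complex.norm_real, Real.norm_eq_abs, abs_div,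
    abs_of_pos (det_vandermondeMatrix_pos p)]
  exact mul_le_of_le_one_left (div_nonneg (abs_nonneg _) (det_vandermondeMatrix_pos p).le)
    (pow_le_one₀ (norm_nonneg _) hs)

theorem sum_norm_lagrangeWeight_le (P : ClassParams) (p : ℕ) {s : ℂ} (hs : ‖s‖ ≤ 1) :
    ∑ k : Fin (p + 1), ‖lagrangeWeight p k s‖ * ((k : ℝ) + 1) ^ (-P.μ) ≤ P.A p := by
  rw [ClassParams.A, Finset.sum_div]
  refine Finset.sum_le_sum fun k _ => ?_
  rw [← Finset.sum_mul, mul_div_right_comm]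
  exact mul_le_mul_of_nonneg_right (norm_lagrangeWeight_le k hs) (by positivity)

/-- The weight of the node `1` at the point `-1` is `(p + 1)(p + 2) / 2` in modulus. -/
theorem add_two_le_A (P : ClassParams) {p : ℕ} (hp : 1 ≤ p) : (p : ℝ) + 2 ≤ P.A p := by
  have h1 : ‖lagrangeWeight p 0 (-1)‖ ≤ P.A p := by
    refine le_trans ?_ (sum_norm_lagrangeWeight_le P p (s := -1) (by simp))
    have := Finset.single_le_sum (f := fun k : Fin (p + 1) =>
      ‖lagrangeWeight p k (-1)‖ * ((k : ℝ) + 1) ^ (-P.μ)) (fun k _ => by positivity)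
      (Finset.mem_univ 0)
    simpa using this
  refine le_trans ?_ h1
  -- Interpolate the polynomial `∏ (X - k)` over the nodes `k = 2, …, p + 1`.
  set Q : Polynomial ℂ := ∏ k : Fin p, (Polynomial.X - Polynomial.C ((k : ℂ) + 2)) with hQ
  have hQd : Q.natDegree ≤ p := by
    rw [hQ, Polynomial.natDegree_prod_of_monic _ _ fun k _ => Polynomial.monic_X_sub_C _]
    simp only [Polynomial.natDegree_X_sub_C, Finset.sum_const, Finset.card_univ,
      Fintype.card_fin, smul_eq_mul, mul_one, le_refl]
  have hQe : ∀ z, Q.eval z = ∏ k : Fin p, (z - ((k : ℂ) + 2)) := fun z => by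
    simp [hQ, Polynomial.eval_prod]
  have h := sum_lagrangeWeight_mul_eval hQd (-1)
  rw [Fin.sum_univ_succ, Finset.sum_eq_zero, add_zero] at h
  swap
  · intro i _
    rw [hQe, Finset.prod_eq_zero (Finset.mem_univ i), mul_zero]
    simp only [Fin.val_succ]; push_cast; ring
  have hl : ∀ m : ℕ, ‖∏ k : Fin m, ((1 : ℂ) - ((k : ℂ) + 2))‖ = (m.factorial : ℝ) := by
    intro m
    rw [norm_prod, Finset.prod_congr rfl (g := fun k : Fin m => ((k : ℕ) : ℝ) + 1),
      Fin.prod_univ_eq_prod_range (fun k : ℕ => (k : ℝ) + 1)]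
    · rw [← Finset.prod_range_add_one_eq_factorial]; push_cast; rfl
    · intro k _
      have : (1 : ℂ) - ((k : ℂ) + 2) = -(((k : ℝ) + 1 : ℝ) : ℂ) := by push_cast; ring
      rw [this, norm_neg, Complex.norm_real, Real.norm_of_nonneg (by positivity)]
  have hr : ∀ m : ℕ, ‖∏ k : Fin m, ((-1 : ℂ) - ((k : ℂ) + 2))‖ = ((m + 2).factorial : ℝ) / 2 := by
    intro m
    rw [norm_prod, Finset.prod_congr rfl (g := fun k : Fin m => ((k : ℕ) : ℝ) + 3),
      Fin.prod_univ_eq_prod_range (fun k : ℕ => (k : ℝ) + 3)]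
    · induction m with
      | zero => simp
      | succ m ih =>
        rw [Finset.prod_range_succ, ih, Nat.factorial_succ (m + 2)]; push_cast; ring
    · intro k _
      have : (-1 : ℂ) - ((k : ℂ) + 2) = -(((k : ℝ) + 3 : ℝ) : ℂ) := by push_cast; ring
      rw [this, norm_neg, Complex.norm_real, Real.norm_of_nonneg (by positivity)]
  have h2 := congrArg norm h
  rw [norm_mul, hQe, hQe, hr] at h2
  have h3 := hl p
  simp only [Fin.val_zero, Nat.cast_zero, zero_add] at h2
  rw [h3, Nat.factorial_succ (p + 1), Nat.factorial_succ p] at h2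
  have hf : (0 : ℝ) < (p.factorial : ℝ) := by positivity
  have h4 : ‖lagrangeWeight p 0 (-1)‖ = ((p : ℝ) + 2) * ((p : ℝ) + 1) / 2 := by
    push_cast at h2
    field_simp
    have : ‖lagrangeWeight p 0 (-1)‖ * 2 * p.factorial = (p + 2) * (p + 1) * p.factorial := by
      nlinarith
    exact mul_right_cancel₀ hf.ne' this
  rw [h4]
  have : (1 : ℝ) ≤ p := by exact_mod_cast hp
  nlinarith

theorem A_pos (P : ClassParams) {p : ℕ} (hp : 1 ≤ p) : 0 < P.A p :=
  lt_of_lt_of_le (by positivity) (add_two_le_A P hp)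

/-! ### Interpolation errors of logarithms and of bounded analytic functions -/

theorem one_sub_le_norm_one_sub_mul {c z : ℂ} {β x : ℝ} (hc : ‖c‖ ≤ β) (hz : ‖z‖ ≤ x) :
    1 - β * x ≤ ‖1 - c * z‖ := by
  have h1 : ‖(1 : ℂ)‖ - ‖c * z‖ ≤ ‖1 - c * z‖ := norm_sub_norm_le _ _
  rw [norm_one, norm_mul] at h1
  have : ‖c‖ * ‖z‖ ≤ β * x :=
    mul_le_mul hc hz (norm_nonneg _) ((norm_nonneg _).trans hc)
  linarith

theorem one_add_inv_pow_succ_le {p : ℕ} (hp : 1 ≤ p) :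
    (((p : ℝ) + 1) / p) ^ (p + 1) ≤ 6 := by
  have hp0 : (0 : ℝ) < p := by exact_mod_cast hp
  have hp1 : (1 : ℝ) ≤ p := by exact_mod_cast hp
  have h1 : ((p : ℝ) + 1) / p ≤ Real.exp (1 / p) := by
    have := Real.add_one_le_exp (1 / (p : ℝ))
    refine le_trans (le_of_eq ?_) this
    field_simp
    ring
  have h2 : (((p : ℝ) + 1) / p) ^ p ≤ 3 := by
    refine (pow_le_pow_left₀ (by positivity) h1 p).trans ?_
    rw [← Real.exp_nat_mul, mul_one_div_cancel hp0.ne']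
    exact Real.exp_one_lt_three.le
  have h3 : ((p : ℝ) + 1) / p ≤ 2 := by rw [div_le_iff₀ hp0]; linarith
  rw [pow_succ]
  calc _ ≤ (3 : ℝ) * 2 := mul_le_mul h2 h3 (by positivity) (by norm_num)
    _ = 6 := by norm_num

theorem le_prod_one_sub_node {p : ℕ} (hp : 1 ≤ p) :
    ((p + 1).factorial : ℝ) * ((p : ℝ) / ((p : ℝ) + 1) ^ 2) ^ (p + 1) ≤
      ∏ k : Fin (p + 1), (1 - (p : ℝ) / ((p : ℝ) + 1) ^ 2 * ((k : ℝ) + 1)) := by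
  have hp0 : (0 : ℝ) < p := by exact_mod_cast hp
  have h1 : ((p + 1).factorial : ℝ) * ((p : ℝ) / ((p : ℝ) + 1) ^ 2) ^ (p + 1) =
      ∏ k : Fin (p + 1), (((Fin.rev k : ℕ) : ℝ) + 1) * ((p : ℝ) / ((p : ℝ) + 1) ^ 2) := by
    rw [Finset.prod_mul_distrib, Finset.prod_const, Finset.card_univ, Fintype.card_fin]
    congr 1
    rw [Fintype.prod_equiv Fin.revPerm (fun k : Fin (p + 1) => ((Fin.rev k : ℕ) : ℝ) + 1)
      (fun k : Fin (p + 1) => ((k : ℕ) : ℝ) + 1) (fun k => by simp),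
      Fin.prod_univ_eq_prod_range (fun k : ℕ => (k : ℝ) + 1),
      ← Finset.prod_range_add_one_eq_factorial]
    push_cast; rfl
  rw [h1]
  refine Finset.prod_le_prod (fun _ _ => by positivity) fun k _ => ?_
  have hk : (k : ℕ) + (Fin.rev k : ℕ) = p := by rw [Fin.val_rev]; omega
  have hk' : ((Fin.rev k : ℕ) : ℝ) = p - (k : ℕ) := by
    rw [eq_sub_iff_add_eq, add_comm]; exact_mod_cast hk
  rw [hk', ← sub_nonneg]
  have : 1 - (p : ℝ) / ((p : ℝ) + 1) ^ 2 * ((k : ℝ) + 1) -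
      ((p : ℝ) - (k : ℕ) + 1) * ((p : ℝ) / ((p : ℝ) + 1) ^ 2) = 1 / ((p : ℝ) + 1) ^ 2 := by
    field_simp; ring
  rw [this]; positivity

theorem norm_le_of_mul_sq_le {p : ℕ} {c : ℂ} (hc : ‖c‖ * ((p : ℝ) + 1) ^ 2 ≤ p) :
    ‖c‖ ≤ (p : ℝ) / ((p : ℝ) + 1) ^ 2 := by
  rwa [le_div_iff₀ (by positivity)]

theorem norm_mul_lt_one {p : ℕ} {c z : ℂ} (hc : ‖c‖ * ((p : ℝ) + 1) ^ 2 ≤ p)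
    (hz : ‖z‖ ≤ (p : ℝ) + 1) : ‖c * z‖ < 1 := by
  rw [norm_mul]
  have h0 : (0 : ℝ) < (p : ℝ) + 1 := by positivity
  have h1 : ‖c‖ * ((p : ℝ) + 1) < 1 := by
    by_contra! h
    nlinarith
  exact (mul_le_mul_of_nonneg_left hz (norm_nonneg _)).trans_lt h1

theorem norm_node_le (p : ℕ) (k : Fin (p + 1)) : ‖(k : ℂ) + 1‖ ≤ (p : ℝ) + 1 :=
  (norm_node p k).le.trans (node_le p k)

theorem one_sub_mul_ne_zero {c z : ℂ} (h : ‖c * z‖ < 1) : 1 - c * z ≠ 0 := by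
  intro h0
  rw [← sub_eq_zero.mp h0, norm_one] at h
  exact lt_irrefl _ h

theorem one_sub_mul_mem_slitPlane {c z : ℂ} (h : ‖c * z‖ < 1) : 1 - c * z ∈ slitPlane := by
  refine Or.inl ?_
  have := (abs_re_le_norm (c * z)).trans_lt h
  rw [sub_re, one_re]
  linarith [(abs_lt.mp this).2]

theorem norm_interpError_inv_one_sub_mul_le {p : ℕ} (hp : 1 ≤ p) {c s : ℂ}
    (hc : ‖c‖ * ((p : ℝ) + 1) ^ 2 ≤ p) (hs : ‖s‖ ≤ 1) :
    ‖interpError p (fun z => (1 - c * z)⁻¹) s‖ ≤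
      8 * ((p : ℝ) + 2) * ((p : ℝ) + 1) ^ (p + 1) * ‖c‖ ^ (p + 1) := by
  have hp0 : (0 : ℝ) < p := by exact_mod_cast hp
  have hsp : ‖s‖ ≤ (p : ℝ) + 1 := by linarith
  set β : ℝ := (p : ℝ) / ((p : ℝ) + 1) ^ 2 with hβ
  have hβ0 : 0 < β := by positivity
  have hcβ : ‖c‖ ≤ β := norm_le_of_mul_sq_le hc
  rw [interpError_inv_one_sub_mul (one_sub_mul_ne_zero (norm_mul_lt_one hc hsp))
    fun k => one_sub_mul_ne_zero (norm_mul_lt_one hc (norm_node_le p k))]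
  rw [norm_div, norm_mul, norm_mul, norm_pow, norm_prod]
  have h1 : (3 / 4 : ℝ) ≤ ‖1 - c * s‖ := by
    have h := one_sub_le_norm_one_sub_mul hcβ hs
    have : β ≤ 1 / 4 := by
      rw [hβ, div_le_iff₀ (by positivity)]
      nlinarith [sq_nonneg ((p : ℝ) - 1)]
    linarith
  have h2 : ((p + 1).factorial : ℝ) * β ^ (p + 1) ≤
      ∏ k : Fin (p + 1), ‖1 - c * ((k : ℂ) + 1)‖ := by
    refine (le_prod_one_sub_node hp).trans (Finset.prod_le_prod (fun k _ => ?_) fun k _ =>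
      one_sub_le_norm_one_sub_mul hcβ (norm_node p k).le)
    have := node_le p k
    rw [sub_nonneg, div_mul_eq_mul_div, div_le_one (by positivity)]
    nlinarith
  have h3 : (0 : ℝ) < ((p + 1).factorial : ℝ) * β ^ (p + 1) := by positivity
  calc _ ≤ ‖c‖ ^ (p + 1) * ((p + 2).factorial : ℝ) /
        (3 / 4 * (((p + 1).factorial : ℝ) * β ^ (p + 1))) := by
        gcongr
        exact norm_nodal_le p hs
    _ = 4 / 3 * ((p : ℝ) + 2) * (((p : ℝ) + 1) / p) ^ (p + 1) *
        ((p : ℝ) + 1) ^ (p + 1) * ‖c‖ ^ (p + 1) := by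
        rw [Nat.factorial_succ (p + 1), hβ]
        have : ((p + 1).factorial : ℝ) ≠ 0 := by positivity
        push_cast
        rw [div_pow, div_pow, ← pow_mul, mul_comm 2 (p + 1), pow_mul]
        have hX : ((p : ℝ) + 1) ^ (p + 1) ≠ 0 := by positivity
        have hY : (p : ℝ) ^ (p + 1) ≠ 0 := by positivity
        generalize ((p : ℝ) + 1) ^ (p + 1) = X at hX ⊢
        generalize (p : ℝ) ^ (p + 1) = Y at hY ⊢
        field_simp
        ring
    _ ≤ 4 / 3 * ((p : ℝ) + 2) * 6 * ((p : ℝ) + 1) ^ (p + 1) * ‖c‖ ^ (p + 1) := by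
        gcongr
        exact one_add_inv_pow_succ_le hp
    _ = _ := by ring

/-- The derivative in `c` of the left-hand side is, up to the factor `-1 / c`, the interpolation
error of `1 / (1 - c z)`; this gives the correct order `‖c‖ ^ (p + 1)` together with a constant
that grows only linearly in `p` once `p + 1` is absorbed into `c`. -/
theorem norm_interpError_log_le {p : ℕ} (hp : 1 ≤ p) {c s : ℂ}
    (hc : ‖c‖ * ((p : ℝ) + 1) ^ 2 ≤ p) (hs : ‖s‖ ≤ 1) :
    ‖interpError p (fun z => log (1 - c * z)) s‖ ≤
      8 * ((p : ℝ) + 2) * ((p : ℝ) + 1) ^ (p + 1) * ‖c‖ ^ (p + 1) := by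
  set Φ : ℂ → ℂ := fun b => interpError p (fun z => log (1 - b * z)) s with hΦ
  have hsp : ‖s‖ ≤ (p : ℝ) + 1 := by linarith [(Nat.cast_nonneg p : (0 : ℝ) ≤ p)]
  have hb : ∀ b ∈ closedBall (0 : ℂ) ‖c‖, ‖b‖ * ((p : ℝ) + 1) ^ 2 ≤ p := fun b hb => by
    refine le_trans (mul_le_mul_of_nonneg_right ?_ (by positivity)) hc
    simpa using hb
  have hd1 : ∀ b ∈ closedBall (0 : ℂ) ‖c‖, ∀ z : ℂ, ‖z‖ ≤ (p : ℝ) + 1 →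
      HasDerivAt (fun b : ℂ => log (1 - b * z)) (-z / (1 - b * z)) b := by
    intro b hbm z hz
    have h1 : HasDerivAt (fun b : ℂ => 1 - b * z) (-z) b := by
      simpa using ((hasDerivAt_id b).mul_const z).const_sub 1
    exact h1.clog (one_sub_mul_mem_slitPlane (norm_mul_lt_one (hb b hbm) hz))
  have hd : ∀ b ∈ closedBall (0 : ℂ) ‖c‖,
      HasDerivAt Φ (interpError p (fun z => -z / (1 - b * z)) s) b := by
    intro b hbm
    simp only [hΦ, interpError]
    refine (hd1 b hbm s hsp).sub (HasDerivAt.fun_sum fun k _ => ?_)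
    exact (hd1 b hbm _ (norm_node_le p k)).const_mul _
  have hbound : ∀ b ∈ closedBall (0 : ℂ) ‖c‖, ‖interpError p (fun z => -z / (1 - b * z)) s‖ ≤
      8 * ((p : ℝ) + 2) * ((p : ℝ) + 1) ^ (p + 1) * ‖c‖ ^ p := by
    intro b hbm
    have hbc : ‖b‖ ≤ ‖c‖ := by simpa using hbm
    rcases eq_or_ne b 0 with rfl | hb0
    · have h0 : (fun z : ℂ => -z / (1 - 0 * z)) = fun z => (-1 : ℂ) * z := by
        funext z; simp
      rw [h0, interpError_const_mul, interpError_id hp]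
      simp only [mul_zero, norm_zero]
      positivity
    · have h0 : interpError p (fun z => -z / (1 - b * z)) s =
          interpError p (fun z => (-b⁻¹) * ((1 - b * z)⁻¹ - 1)) s := by
        refine interpError_congr (T := {z | ‖z‖ ≤ (p : ℝ) + 1}) (fun z hz => ?_) hsp
          (norm_node_le p)
        have := one_sub_mul_ne_zero (norm_mul_lt_one (hb b hbm) hz)
        change -z / (1 - b * z) = -b⁻¹ * ((1 - b * z)⁻¹ - 1)
        rw [inv_eq_one_div (1 - b * z), div_sub_one this, mul_div_assoc', sub_sub_cancel,
          neg_mul, inv_mul_cancel_left₀ hb0]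
      rw [h0, interpError_const_mul, interpError_sub, interpError_const, sub_zero, norm_mul,
        norm_neg, norm_inv]
      have h1 := norm_interpError_inv_one_sub_mul_le hp (hb b hbm) hs
      have hbpos : 0 < ‖b‖ := norm_pos_iff.mpr hb0
      calc _ ≤ ‖b‖⁻¹ * (8 * ((p : ℝ) + 2) * ((p : ℝ) + 1) ^ (p + 1) * ‖b‖ ^ (p + 1)) := by gcongr
        _ = 8 * ((p : ℝ) + 2) * ((p : ℝ) + 1) ^ (p + 1) * ‖b‖ ^ p := by
          rw [pow_succ ‖b‖]; field_simp
        _ ≤ _ := by gcongr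
  have h := (convex_closedBall (0 : ℂ) ‖c‖).norm_image_sub_le_of_norm_hasDerivWithin_le
    (fun b hbm => (hd b hbm).hasDerivWithinAt) hbound (mem_closedBall_self (norm_nonneg _))
    (show c ∈ closedBall (0 : ℂ) ‖c‖ by simp)
  have h0 : Φ 0 = 0 := by
    simp only [hΦ, zero_mul, sub_zero, log_one]
    exact interpError_const p 0 s
  rw [h0, sub_zero, sub_zero] at h
  refine h.trans (le_of_eq ?_)
  rw [pow_succ ‖c‖]; ring

/-- Cauchy's formula turns the interpolation error of a function analytic on a large disc into an
integral of the interpolation errors of the Cauchy kernels. -/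
theorem norm_interpError_le_of_diffContOnCl {p : ℕ} {F : ℂ → ℂ} {ϱ B : ℝ}
    (hϱ : 2 * ((p : ℝ) + 1) ≤ ϱ) (hF : DiffContOnCl ℂ F (ball 0 ϱ))
    (hB : ∀ z ∈ sphere (0 : ℂ) ϱ, ‖F z‖ ≤ B) {s : ℂ} (hs : ‖s‖ ≤ 1) :
    ‖interpError p F s‖ ≤ ((p + 2).factorial : ℝ) * 2 ^ (p + 2) * B / ϱ ^ (p + 1) := by
  have hp0 : (0 : ℝ) ≤ p := Nat.cast_nonneg p
  have hϱ0 : 0 < ϱ := by linarith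
  have hlt : ∀ z : ℂ, ‖z‖ ≤ (p : ℝ) + 1 → z ∈ ball (0 : ℂ) ϱ := fun z hz => by
    rw [mem_ball_zero_iff]; linarith
  have hsp : ‖s‖ ≤ (p : ℝ) + 1 := by linarith
  have hcauchy : ∀ w : ℂ, ‖w‖ ≤ (p : ℝ) + 1 →
      (∮ z in C(0, ϱ), (z - w)⁻¹ * F z) = 2 * Real.pi * I * F w := fun w hw => by
    simpa using hF.circleIntegral_sub_inv_smul (hlt w hw)
  have hne : ∀ z ∈ sphere (0 : ℂ) ϱ, ∀ w : ℂ, ‖w‖ ≤ (p : ℝ) + 1 → z - w ≠ 0 := by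
    intro z hz w hw h
    have := hlt w hw
    rw [← sub_eq_zero.mp h, mem_ball_zero_iff] at this
    rw [mem_sphere_zero_iff_norm] at hz
    linarith
  have hint : ∀ w : ℂ, ‖w‖ ≤ (p : ℝ) + 1 →
      CircleIntegrable (fun z => (z - w)⁻¹ * F z) 0 ϱ := by
    intro w hw
    refine ContinuousOn.circleIntegrable hϱ0.le (ContinuousOn.mul ?_ ?_)
    · exact ContinuousOn.inv₀ (by fun_prop) fun z hz => hne z hz w hw
    · refine hF.continuousOn.mono ?_
      rw [closure_ball _ hϱ0.ne']
      exact sphere_subset_closedBall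
  have hint' : ∀ k : Fin (p + 1), CircleIntegrable
      (fun z => lagrangeWeight p k s * ((z - ((k : ℂ) + 1))⁻¹ * F z)) 0 ϱ :=
    fun k => (hint _ (norm_node_le p k)).const_smul
  have hrep : 2 * Real.pi * I * interpError p F s =
      ∮ z in C(0, ϱ), interpError p (fun w => (z - w)⁻¹) s * F z := by
    simp only [interpError, sub_mul, Finset.sum_mul, mul_assoc]
    rw [circleIntegral.integral_sub (hint s hsp)]
    · rw [circleIntegral.integral_fun_sum]
      · simp only [circleIntegral.integral_const_mul]
        rw [hcauchy s hsp, mul_sub, mul_sub, mul_sub, Finset.mul_sum, Finset.mul_sum, Finset.mul_sum]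
        congr 1
        · ring
        · refine Finset.sum_congr rfl fun k _ => ?_
          rw [hcauchy _ (norm_node_le p k)]
          ring
      · exact fun k _ => hint' k
    · exact CircleIntegrable.fun_sum _ fun k _ => hint' k
  have hker : ∀ z ∈ sphere (0 : ℂ) ϱ, ‖interpError p (fun w => (z - w)⁻¹) s * F z‖ ≤
      ((p + 2).factorial : ℝ) * 2 ^ (p + 2) / ϱ ^ (p + 2) * B := by
    intro z hz
    have hzn : ‖z‖ = ϱ := by simpa using hz
    have hz0 : z ≠ 0 := by
      intro h
      rw [h, norm_zero] at hzn
      linarith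
    have hhalf : ∀ w : ℂ, ‖w‖ ≤ (p : ℝ) + 1 → 1 / 2 ≤ ‖1 - z⁻¹ * w‖ := by
      intro w hw
      have h1 := one_sub_le_norm_one_sub_mul (le_refl ‖z⁻¹‖) hw
      have : ‖z⁻¹‖ * ((p : ℝ) + 1) ≤ 1 / 2 := by
        rw [norm_inv, hzn, inv_mul_le_iff₀ hϱ0]; linarith
      linarith
    have hnz : ∀ w : ℂ, ‖w‖ ≤ (p : ℝ) + 1 → 1 - z⁻¹ * w ≠ 0 := by
      intro w hw h
      have := hhalf w hw
      rw [h, norm_zero] at this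
      norm_num at this
    have heq : interpError p (fun w => (z - w)⁻¹) s =
        interpError p (fun w => z⁻¹ * (1 - z⁻¹ * w)⁻¹) s := by
      congr 1
      funext w
      rw [← mul_inv, mul_sub, mul_one, mul_inv_cancel_left₀ hz0]
    rw [norm_mul]
    refine mul_le_mul ?_ (hB z hz) (norm_nonneg _) (by positivity)
    rw [heq, interpError_const_mul, interpError_inv_one_sub_mul (hnz s hsp)
      fun k => hnz _ (norm_node_le p k), norm_mul, norm_div, norm_mul, norm_mul, norm_pow,
      norm_prod, norm_inv, hzn]
    have hprod : (1 / 2 : ℝ) ^ (p + 1) ≤ ∏ k : Fin (p + 1), ‖1 - z⁻¹ * ((k : ℂ) + 1)‖ := by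
      have := Finset.prod_le_prod (s := (Finset.univ : Finset (Fin (p + 1))))
        (f := fun _ => (1 / 2 : ℝ)) (fun _ _ => by norm_num)
        fun k _ => hhalf _ (norm_node_le p k)
      simpa using this
    calc _ ≤ ϱ⁻¹ * (ϱ⁻¹ ^ (p + 1) * ((p + 2).factorial : ℝ) / (1 / 2 * (1 / 2) ^ (p + 1))) := by
          gcongr
          · exact norm_nodal_le p hs
          · exact hhalf s hsp
      _ = _ := by
          rw [inv_pow, one_div, inv_pow]
          field_simp
          ring
  have h := circleIntegral.norm_integral_le_of_norm_le_const hϱ0.le hker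
  rw [← hrep, norm_mul] at h
  have h2 : ‖(2 * Real.pi * I : ℂ)‖ = 2 * Real.pi := by
    simp [abs_of_pos Real.pi_pos]
  rw [h2] at h
  have h3 : 2 * Real.pi * ‖interpError p F s‖ ≤ 2 * Real.pi *
      (((p + 2).factorial : ℝ) * 2 ^ (p + 2) * B / ϱ ^ (p + 1)) := by
    refine h.trans (le_of_eq ?_)
    rw [pow_succ ϱ (p + 1)]
    field_simp
  exact le_of_mul_le_mul_left h3 (by positivity)

/-! ### Zeros of entire functions -/

theorem analyticOrderAt_ne_top_of_entire {ψ : ℂ → ℂ} (hψ : Differentiable ℂ ψ) {z₀ : ℂ}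
    (h0 : ψ z₀ ≠ 0) (z : ℂ) : analyticOrderAt ψ z ≠ ⊤ := by
  have ha : AnalyticOnNhd ℂ ψ Set.univ := fun w _ => hψ.analyticAt w
  refine ha.analyticOrderAt_ne_top_of_isPreconnected (x := z₀) isPreconnected_univ
    (Set.mem_univ _) (Set.mem_univ _) ?_
  rw [(hψ.analyticAt z₀).analyticOrderAt_eq_zero.mpr h0]
  exact ENat.zero_ne_top

theorem finite_zeros_inter_ball {ψ : ℂ → ℂ} (hψ : Differentiable ℂ ψ) {z₀ : ℂ}
    (h0 : ψ z₀ ≠ 0) (T : ℝ) : {z | z ∈ ball (0 : ℂ) T ∧ ψ z = 0}.Finite := by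
  have ha : AnalyticOnNhd ℂ ψ Set.univ := fun w _ => hψ.analyticAt w
  have h := (isCompact_closedBall (0 : ℂ) T).finite_sdiff_of_mem_codiscreteWithin
    (Filter.codiscreteWithin_mono (Set.subset_univ _) (ha.preimage_zero_mem_codiscrete h0))
  exact h.subset fun z hz => ⟨ball_subset_closedBall hz.1, by simpa using hz.2⟩

theorem exists_eq_pow_mul {ψ : ℂ → ℂ} (hψ : Differentiable ℂ ψ) (a : ℂ) (m : ℕ)
    (hm : (m : ℕ∞) ≤ analyticOrderAt ψ a) :
    ∃ g : ℂ → ℂ, Differentiable ℂ g ∧ ∀ z, ψ z = (z - a) ^ m * g z := by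
  induction m with
  | zero => exact ⟨ψ, hψ, fun z => by simp⟩
  | succ m ih =>
    obtain ⟨g, hg, hgz⟩ := ih (le_trans (by exact_mod_cast m.le_succ) hm)
    have hord : analyticOrderAt ψ a = m + analyticOrderAt g a := by
      have h : ψ = (fun z => z - a) ^ m * g := funext hgz
      rw [h, analyticOrderAt_mul (by fun_prop) (hg.analyticAt a),
        analyticOrderAt_centeredMonomial]
    have hga : g a = 0 := by
      refine apply_eq_zero_of_analyticOrderAt_ne_zero fun h => ?_
      rw [hord, h, add_zero] at hm
      exact absurd (by exact_mod_cast hm : m + 1 ≤ m) (by omega)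
    refine ⟨dslope g a, ?_, fun z => ?_⟩
    · rw [← differentiableOn_univ]
      exact (differentiableOn_dslope Filter.univ_mem).mpr hg.differentiableOn
    · rw [hgz, pow_succ, mul_assoc]
      congr 1
      have := sub_smul_dslope g a z
      rw [hga, sub_zero, smul_eq_mul] at this
      exact this.symm

/-- Dividing out the zeros of `ψ` at the points of `Z`, with multiplicities. -/
theorem exists_eq_prod_mul {ψ : ℂ → ℂ} (hψ : Differentiable ℂ ψ)
    (hfin : ∀ z, analyticOrderAt ψ z ≠ ⊤) (Z : Finset ℂ) :
    ∃ g : ℂ → ℂ, Differentiable ℂ g ∧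
      (∀ z, ψ z = (∏ a ∈ Z, (z - a) ^ analyticOrderNatAt ψ a) * g z) ∧
      (∀ z ∈ Z, g z ≠ 0) ∧ ∀ z ∉ Z, analyticOrderAt g z = analyticOrderAt ψ z := by
  classical
  induction Z using Finset.induction_on with
  | empty => exact ⟨ψ, hψ, fun z => by simp, by simp, fun z _ => rfl⟩
  | insert b Z hb ih =>
    obtain ⟨g, hg, hgz, hgZ, hgo⟩ := ih
    have hbo : ((analyticOrderNatAt ψ b : ℕ) : ℕ∞) = analyticOrderAt g b := by
      rw [Nat.cast_analyticOrderNatAt (hfin b), hgo b hb]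
    obtain ⟨g', hg', hgz'⟩ := exists_eq_pow_mul hg b _ hbo.le
    have hfun : g = (fun z => (z - b) ^ analyticOrderNatAt ψ b) * g' := funext hgz'
    have hord : ∀ z, analyticOrderAt g z =
        analyticOrderAt (fun z => (z - b) ^ analyticOrderNatAt ψ b) z + analyticOrderAt g' z := by
      intro z
      conv_lhs => rw [hfun]
      exact analyticOrderAt_mul (by fun_prop) (hg'.analyticAt z)
    have hne : ∀ z, z ≠ b →
        analyticOrderAt (fun z => (z - b) ^ analyticOrderNatAt ψ b) z = 0 := fun z hz => by
      rw [analyticOrderAt_eq_zero]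
      exact Or.inr (pow_ne_zero _ (sub_ne_zero.mpr hz))
    refine ⟨g', hg', fun z => ?_, fun z hz h0 => ?_, fun z hz => ?_⟩
    · rw [hgz, hgz', Finset.prod_insert hb]; ring
    · rcases Finset.mem_insert.mp hz with rfl | hz
      · have h := hord z
        rw [← hbo] at h
        have hm : analyticOrderAt (fun w => (w - z) ^ analyticOrderNatAt ψ z) z =
            (analyticOrderNatAt ψ z : ℕ) := analyticOrderAt_centeredMonomial
        rw [hm] at h
        have h' : analyticOrderAt g' z = 0 := by
          have h2 : ((analyticOrderNatAt ψ z : ℕ) : ℕ∞) + 0 =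
            (analyticOrderNatAt ψ z : ℕ) + analyticOrderAt g' z := by rw [add_zero]; exact h
          exact (ENat.add_right_injective_of_ne_top (ENat.natCast_ne_top _) h2).symm
        exact ((hg'.analyticAt z).analyticOrderAt_eq_zero.mp h') h0
      · refine hgZ z hz ?_
        rw [hgz', h0, mul_zero]
    · rw [Finset.mem_insert, not_or] at hz
      rw [← hgo z hz.2, hord z, hne z hz.1, zero_add]

/-! ### Blaschke products -/

/-- On `‖z‖ = T` the factor `T (z - a) / (T ^ 2 - conj a * z)` is unimodular. -/
theorem norm_sub_eq_of_norm_eq {T : ℝ} (hT : 0 < T) {z : ℂ} (hz : ‖z‖ = T) (a : ℂ) :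
    ‖((T : ℂ) ^ 2 - (starRingEnd ℂ) a * z) / T‖ = ‖z - a‖ := by
  have h1 : (T : ℂ) ^ 2 = z * (starRingEnd ℂ) z := by
    rw [mul_conj, normSq_eq_norm_sq, hz]; push_cast; rfl
  have h2 : (T : ℂ) ^ 2 - (starRingEnd ℂ) a * z = z * (starRingEnd ℂ) (z - a) := by
    rw [h1, map_sub]; ring
  rw [h2, norm_div, norm_mul, hz, Complex.norm_real, Real.norm_of_nonneg hT.le, norm_conj]
  field_simp

/-- Replacing the zeros of `ψ` in `Z` by their reflections in the circle `‖z‖ = T` preserves the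
modulus on this circle, so that the maximum principle bounds the new function. -/
theorem norm_mul_prod_le {ψ g : ℂ → ℂ} {T M : ℝ} (hT : 0 < T) (hg : Differentiable ℂ g)
    {Z : Finset ℂ} {m : ℂ → ℕ} (hψ : ∀ z, ψ z = (∏ a ∈ Z, (z - a) ^ m a) * g z)
    (hM : ∀ z, ‖z‖ = T → ‖ψ z‖ ≤ M) {z : ℂ} (hz : ‖z‖ ≤ T) :
    ‖(∏ a ∈ Z, (((T : ℂ) ^ 2 - (starRingEnd ℂ) a * z) / T) ^ m a) * g z‖ ≤ M := by
  have hd : Differentiable ℂ fun z : ℂ =>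
      (∏ a ∈ Z, (((T : ℂ) ^ 2 - (starRingEnd ℂ) a * z) / T) ^ m a) * g z := by
    fun_prop
  refine norm_le_of_forall_mem_frontier_norm_le (U := ball (0 : ℂ) T)
    (f := fun z : ℂ => (∏ a ∈ Z, (((T : ℂ) ^ 2 - (starRingEnd ℂ) a * z) / T) ^ m a) * g z)
    isBounded_ball hd.diffContOnCl (fun w hw => ?_) ?_
  · rw [frontier_ball _ hT.ne', mem_sphere_zero_iff_norm] at hw
    rw [norm_mul, norm_prod]
    simp only [norm_pow, norm_sub_eq_of_norm_eq hT hw]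
    refine le_trans (le_of_eq ?_) (hM w hw)
    rw [hψ, norm_mul, norm_prod]
    simp only [norm_pow]
  · rwa [closure_ball _ hT.ne', mem_closedBall_zero_iff]

/-- With `T = 2 e t`, points of modulus at most `t` have pseudo-hyperbolic distance at most `1 / e`
in the disc of radius `T`. -/
theorem exp_one_mul_norm_sub_le {t : ℝ} (ht : 0 < t) {a z : ℂ} (ha : ‖a‖ ≤ t) (hz : ‖z‖ = t) :
    Real.exp 1 * ‖z - a‖ ≤
      ‖(((2 * Real.exp 1 * t : ℝ) : ℂ) ^ 2 - (starRingEnd ℂ) a * z) / (2 * Real.exp 1 * t : ℝ)‖ := by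
  set e := Real.exp 1 with he
  have he1 : 1 < e := by rw [he]; exact Real.one_lt_exp_iff.mpr one_pos
  set T : ℝ := 2 * e * t with hT
  have hT0 : 0 < T := by positivity
  rw [norm_div, Complex.norm_real, Real.norm_of_nonneg hT0.le, le_div_iff₀ hT0]
  refine le_of_sq_le_sq ?_ (norm_nonneg _)
  set X := ((starRingEnd ℂ) a * z).re with hX
  have h1 : ‖z - a‖ ^ 2 = t ^ 2 + ‖a‖ ^ 2 - 2 * X := by
    rw [← normSq_eq_norm_sq, normSq_sub, normSq_eq_norm_sq, normSq_eq_norm_sq, hz, hX,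
      mul_comm z]
  have h2 : ‖(T : ℂ) ^ 2 - (starRingEnd ℂ) a * z‖ ^ 2 =
      T ^ 4 + ‖a‖ ^ 2 * t ^ 2 - 2 * T ^ 2 * X := by
    rw [← normSq_eq_norm_sq, normSq_sub, normSq_eq_norm_sq, normSq_eq_norm_sq, norm_mul, norm_conj,
      hz, ← ofReal_pow, Complex.norm_real, re_ofReal_mul, conj_re,
      Real.norm_of_nonneg (by positivity)]
    ring
  have hXl : -(‖a‖ * t) ≤ X := by
    have := abs_re_le_norm ((starRingEnd ℂ) a * z)
    rw [norm_mul, norm_conj, hz] at this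
    exact (abs_le.mp this).1
  rw [mul_pow, mul_pow, h1, h2]
  have ha0 := norm_nonneg a
  generalize ‖a‖ = b at *
  -- The difference is affine in `X` with nonnegative slope, and a difference of squares at the end.
  have hmain : e * T * (t + b) ≤ T ^ 2 + b * t := by
    rw [hT]
    have h3 : 0 ≤ e ^ 2 * t * (t - b) := by
      have : 0 ≤ t - b := by linarith
      positivity
    nlinarith [mul_nonneg ha0 ht.le]
  have hsq : (e * T * (t + b)) ^ 2 ≤ (T ^ 2 + b * t) ^ 2 :=
    pow_le_pow_left₀ (by positivity) hmain 2
  have hlin : 0 ≤ 2 * T ^ 2 * (e ^ 2 - 1) * (X + b * t) := by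
    have h4 : 0 ≤ e ^ 2 - 1 := by nlinarith
    have h5 : 0 ≤ X + b * t := by linarith
    positivity
  nlinarith

/-! ### Counting zeros of functions of the class -/

namespace ClassParams

theorem r₀_le_r₁ (P : ClassParams) : P.r₀ ≤ P.r₁ := le_max_left _ _

theorem Admissible.one_le_r₁ {P : ClassParams} (hP : P.Admissible) : 1 ≤ P.r₁ :=
  hP.one_le_r₀.trans (r₀_le_r₁ P)

theorem norm_ray (φ : ℝ) {t : ℝ} (ht : 0 ≤ t) :
    ‖(t : ℂ) * Complex.exp ((φ : ℂ) * Complex.I)‖ = t := by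
  rw [norm_mul, norm_exp_ofReal_mul_I, mul_one, Complex.norm_real, Real.norm_of_nonneg ht]

theorem Mem.half_le_norm {P : ClassParams} (hP : P.Admissible) {φ : ℝ} {ψ : ℂ → ℂ}
    (hψ : P.Mem φ ψ) {t : ℝ} (ht : P.r₁ ≤ t) :
    1 / 2 ≤ ‖ψ ((t : ℂ) * Complex.exp ((φ : ℂ) * Complex.I))‖ := by
  have ht0 : 0 < t := one_pos.trans_le (hP.one_le_r₁.trans ht)
  have h1 := hψ.ray t ((r₀_le_r₁ P).trans ht)
  have h2 : (2 * P.C₁) ^ (1 / P.μ) ≤ t :=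
    ((le_max_left _ _).trans (le_max_right _ _)).trans ht
  have hC := hP.C₁_pos
  have hμ := hP.μ_pos
  have h3 : 2 * P.C₁ ≤ t ^ P.μ := by
    have := Real.rpow_le_rpow (by positivity) h2 hμ.le
    rwa [← Real.rpow_mul (by positivity), one_div_mul_cancel hμ.ne', Real.rpow_one] at this
  have h4 : P.C₁ / t ^ P.μ ≤ 1 / 2 := by
    rw [div_le_iff₀ (by positivity)]; linarith
  have h5 := norm_sub_norm_le (1 : ℂ)
    (1 - ψ ((t : ℂ) * Complex.exp ((φ : ℂ) * Complex.I)))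
  rw [sub_sub_cancel, norm_one, norm_sub_rev] at h5
  linarith

theorem Admissible.log_le {P : ClassParams} (hP : P.Admissible) {t : ℝ} (ht : P.r₁ ≤ t) :
    Real.log (2 * P.C₀) ≤ P.σ * (2 * Real.exp 1 * t) ^ P.ρ := by
  have ht0 : 0 < t := one_pos.trans_le (hP.one_le_r₁.trans ht)
  have hσ := hP.σ_pos
  have hρ := hP.ρ_pos
  have h2 : 1 / (2 * Real.exp 1) * (max 0 (Real.log (2 * P.C₀)) / P.σ) ^ (1 / P.ρ) ≤ t :=
    ((le_max_right _ _).trans (le_max_right _ _)).trans ht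
  have hm : 0 ≤ max 0 (Real.log (2 * P.C₀)) / P.σ := div_nonneg (le_max_left _ _) hσ.le
  have h3 : (max 0 (Real.log (2 * P.C₀)) / P.σ) ^ (1 / P.ρ) ≤ 2 * Real.exp 1 * t := by
    rw [one_div_mul_eq_div, div_le_iff₀ (by positivity)] at h2
    linarith
  have h4 := Real.rpow_le_rpow (by positivity) h3 hρ.le
  rw [← Real.rpow_mul hm, one_div_mul_cancel hρ.ne', Real.rpow_one, div_le_iff₀ hσ] at h4
  linarith [le_max_right 0 (Real.log (2 * P.C₀))]

/-- Jensen-type bound for the number of zeros in the disc of radius `t`. The point `t e ^ (iφ)`,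
where `ψ` is not small, replaces the usual centre. -/
theorem Mem.sum_multiplicity_le {P : ClassParams} (hP : P.Admissible) {φ : ℝ} {ψ g : ℂ → ℂ}
    (hψ : P.Mem φ ψ) (hg : Differentiable ℂ g) {Z : Finset ℂ} {m : ℂ → ℕ}
    (hZ : ∀ z, ψ z = (∏ a ∈ Z, (z - a) ^ m a) * g z) {t : ℝ} (ht : P.r₁ ≤ t) :
    ∑ a ∈ Z with ‖a‖ ≤ t, (m a : ℝ) ≤ 2 * P.σ * (2 * Real.exp 1) ^ P.ρ * t ^ P.ρ := by
  have ht0 : 0 < t := one_pos.trans_le (hP.one_le_r₁.trans ht)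
  have hC₀ := hP.C₀_pos
  set T : ℝ := 2 * Real.exp 1 * t with hT
  have hT0 : 0 < T := by positivity
  have htT : t ≤ T := by
    have : (1 : ℝ) ≤ 2 * Real.exp 1 := by linarith [Real.add_one_le_exp (1 : ℝ)]
    nlinarith
  set z₀ : ℂ := (t : ℂ) * Complex.exp ((φ : ℂ) * Complex.I) with hz₀
  have hz₀n : ‖z₀‖ = t := norm_ray φ ht0.le
  set Z₁ := Z.filter fun a => ‖a‖ ≤ t
  have hsplit : ∀ z, ψ z = (∏ a ∈ Z₁, (z - a) ^ m a) *
      ((∏ a ∈ Z.filter fun a => ¬ ‖a‖ ≤ t, (z - a) ^ m a) * g z) := fun z => by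
    rw [hZ, ← mul_assoc, Finset.prod_filter_mul_prod_filter_not]
  have hM : ∀ z : ℂ, ‖z‖ = T → ‖ψ z‖ ≤ P.C₀ * Real.exp (P.σ * T ^ P.ρ) := fun z hz => by
    have := hψ.growth z (by rw [hz]; exact ((r₀_le_r₁ P).trans ht).trans htT)
    rwa [hz] at this
  have hmax := norm_mul_prod_le hT0 (by fun_prop) hsplit hM (z := z₀) (hz₀n.le.trans htT)
  have hlow : Real.exp (∑ a ∈ Z₁, (m a : ℝ)) * ‖ψ z₀‖ ≤ P.C₀ * Real.exp (P.σ * T ^ P.ρ) := by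
    refine le_trans ?_ hmax
    rw [hsplit z₀, norm_mul, norm_mul _ (_ * _), ← mul_assoc, norm_prod, norm_prod, Real.exp_sum,
      ← Finset.prod_mul_distrib]
    refine mul_le_mul_of_nonneg_right (Finset.prod_le_prod (fun _ _ => by positivity)
      fun a ha => ?_) (norm_nonneg _)
    have hat : ‖a‖ ≤ t := (Finset.mem_filter.mp ha).2
    rw [norm_pow, norm_pow, ← mul_one ((m a : ℝ)), Real.exp_nat_mul, ← mul_pow]
    exact pow_le_pow_left₀ (by positivity) (exp_one_mul_norm_sub_le ht0 hat hz₀n) _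
  have hhalf := hψ.half_le_norm hP ht
  have h1 : Real.exp (∑ a ∈ Z₁, (m a : ℝ)) ≤ 2 * P.C₀ * Real.exp (P.σ * T ^ P.ρ) := by
    have := Real.exp_pos (∑ a ∈ Z₁, (m a : ℝ))
    nlinarith
  have h2 : ∑ a ∈ Z₁, (m a : ℝ) ≤ Real.log (2 * P.C₀) + P.σ * T ^ P.ρ := by
    rw [← Real.log_exp (P.σ * T ^ P.ρ), ← Real.log_mul (by positivity) (by positivity)]
    exact (Real.le_log_iff_exp_le (by positivity)).mpr h1
  have h3 := hP.log_le ht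
  have h4 : T ^ P.ρ = (2 * Real.exp 1) ^ P.ρ * t ^ P.ρ := Real.mul_rpow (by positivity) ht0.le
  rw [← hT, h4] at h3
  rw [h4] at h2
  linarith

end ClassParams

/-- Summation by parts: a bound for the counting function of a finite weighted family outside the
disc of radius `R` bounds the sum of the `n`-th powers of the reciprocals. -/
theorem sum_mul_norm_rpow_neg_le {Z : Finset ℂ} {w : ℂ → ℝ} {R N ρ n : ℝ}
    (hR : 0 < R) (hρ : 0 < ρ) (hn : ρ < n) (hZ : ∀ a ∈ Z, R ≤ ‖a‖) (hw : ∀ a ∈ Z, 0 ≤ w a)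
    (hN : ∀ t, R ≤ t → ∑ a ∈ Z with ‖a‖ ≤ t, w a ≤ N * t ^ ρ) :
    ∑ a ∈ Z, w a * ‖a‖ ^ (-n) ≤ N * n / (n - ρ) * R ^ (ρ - n) := by
  have hn0 : 0 < n := hρ.trans hn
  set f : ℝ → ℝ := fun t => n * t ^ (-n - 1) with hf
  have hfi : ∀ r : ℝ, 0 < r → MeasureTheory.IntegrableOn f (Set.Ioi r) := fun r hr =>
    (integrableOn_Ioi_rpow_of_lt (by linarith) hr).const_mul n
  have hfv : ∀ r : ℝ, 0 < r → ∫ t in Set.Ioi r, f t = r ^ (-n) := fun r hr => by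
    simp only [hf]
    rw [MeasureTheory.integral_const_mul, integral_Ioi_rpow_of_lt (by linarith) hr,
      show -n - 1 + 1 = -n by ring]
    field_simp
  have hterm : ∀ a ∈ Z, w a * ‖a‖ ^ (-n) =
      ∫ t in Set.Ioi R, w a * (Set.Ioi ‖a‖).indicator f t := fun a ha => by
    rw [MeasureTheory.integral_const_mul, MeasureTheory.setIntegral_indicator measurableSet_Ioi,
      Set.Ioi_inter_Ioi, sup_eq_right.mpr (hZ a ha), hfv _ (hR.trans_le (hZ a ha))]
  have hint : ∀ a ∈ Z, MeasureTheory.IntegrableOn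
      (fun t => w a * (Set.Ioi ‖a‖).indicator f t) (Set.Ioi R) := fun a _ =>
    ((hfi R hR).indicator measurableSet_Ioi).const_mul _
  rw [Finset.sum_congr rfl hterm, ← MeasureTheory.integral_finsetSum _ hint]
  have hbound : ∀ t ∈ Set.Ioi R, ∑ a ∈ Z, w a * (Set.Ioi ‖a‖).indicator f t ≤
      N * n * t ^ (ρ - n - 1) := by
    intro t ht
    have ht0 : 0 < t := hR.trans ht
    have hft : 0 ≤ f t := by simp only [hf]; positivity
    calc _ ≤ ∑ a ∈ Z, (if ‖a‖ ≤ t then w a else 0) * f t := by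
          refine Finset.sum_le_sum fun a ha => ?_
          have hwa := hw a ha
          by_cases hat : ‖a‖ < t
          · rw [Set.indicator_of_mem (Set.mem_Ioi.mpr hat), if_pos hat.le]
          · rw [Set.indicator_of_notMem (by simpa using hat), mul_zero]
            split_ifs <;> positivity
      _ = (∑ a ∈ Z with ‖a‖ ≤ t, w a) * f t := by
          rw [← Finset.sum_mul, Finset.sum_filter]
      _ ≤ N * t ^ ρ * f t := by
          gcongr
          exact hN t (le_of_lt ht)
      _ = _ := by
          simp only [hf]
          rw [show ρ - n - 1 = ρ + (-n - 1) by ring, Real.rpow_add ht0]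
          ring
  refine (MeasureTheory.setIntegral_mono_on (MeasureTheory.integrable_finsetSum _ hint)
    ((integrableOn_Ioi_rpow_of_lt (by linarith) hR).const_mul (N * n)) measurableSet_Ioi
    hbound).trans (le_of_eq ?_)
  rw [MeasureTheory.integral_const_mul, integral_Ioi_rpow_of_lt (by linarith) hR,
    show ρ - n - 1 + 1 = -(n - ρ) by ring, show ρ - n = -(n - ρ) by ring]
  have : n - ρ ≠ 0 := by linarith
  field_simp

/-! ### Branches of the logarithm -/

/-- Two continuous logarithms of the same function on a preconnected set differ by a constant. -/
theorem sub_eq_sub_of_exp_eq {X : Type*} [TopologicalSpace X] {S : Set X} (hS : IsPreconnected S)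
    {u v : X → ℂ} (hu : ContinuousOn u S) (hv : ContinuousOn v S)
    (h : ∀ x ∈ S, exp (u x) = exp (v x)) {x y : X} (hx : x ∈ S) (hy : y ∈ S) :
    u x - v x = u y - v y := by
  have hd : IsDiscrete {w : ℂ | exp w = 1} := by
    rw [isDiscrete_iff_discreteTopology]
    refine DiscreteTopology.of_forall_le_dist (r := 1) one_pos fun a b hab => ?_
    obtain ⟨n, hn⟩ := Complex.exp_eq_one_iff.mp a.2
    obtain ⟨k, hk⟩ := Complex.exp_eq_one_iff.mp b.2
    have hnk : n ≠ k := fun h => hab (Subtype.ext (by rw [hn, hk, h]))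
    have h1 : (1 : ℝ) ≤ |((n - k : ℤ) : ℝ)| := by
      rw [← Int.cast_abs]
      exact_mod_cast Int.one_le_abs (sub_ne_zero.mpr hnk)
    rw [Subtype.dist_eq, dist_eq_norm, hn, hk,
      show (n : ℂ) * (2 * Real.pi * I) - k * (2 * Real.pi * I) =
        (((n - k : ℤ) : ℝ) : ℂ) * ((2 * Real.pi : ℝ) : ℂ) * I by push_cast; ring,
      norm_mul, norm_mul, norm_I, mul_one, Complex.norm_real, Complex.norm_real,
      Real.norm_eq_abs, Real.norm_of_nonneg Real.two_pi_pos.le]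
    nlinarith [Real.pi_gt_three]
  refine hS.constant_of_mapsTo hd (hu.sub hv) (fun z hz => ?_) hx hy
  change exp (u z - v z) = 1
  rw [exp_sub, h z hz, div_self (exp_ne_zero _)]

theorem exists_log_of_ne_zero {f : ℂ → ℂ} {T : ℝ} (hf : DifferentiableOn ℂ f (ball 0 T))
    (h0 : ∀ z ∈ ball (0 : ℂ) T, f z ≠ 0) :
    ∃ u : ℂ → ℂ, DifferentiableOn ℂ u (ball 0 T) ∧ ∀ z ∈ ball (0 : ℂ) T, exp (u z) = f z := by
  rcases le_or_gt T 0 with hT | hT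
  · exact ⟨0, by simp [ball_eq_empty.mpr hT], by simp [ball_eq_empty.mpr hT]⟩
  have h0T : (0 : ℂ) ∈ ball (0 : ℂ) T := mem_ball_self hT
  have hd : DifferentiableOn ℂ (fun z => deriv f z / f z) (ball 0 T) :=
    (hf.deriv isOpen_ball).div hf h0
  obtain ⟨u, hu0, hu⟩ := (DifferentiableOn.isExactOn_ball hd).with_val_at 0 (log (f 0))
  have hud : ∀ z ∈ ball (0 : ℂ) T, HasDerivAt u (deriv f z / f z) z := hu
  refine ⟨u, fun z hz => (hud z hz).differentiableAt.differentiableWithinAt, fun z hz => ?_⟩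
  have hconst : ∀ w ∈ ball (0 : ℂ) T, HasDerivAt (fun w => f w * exp (-u w)) 0 w := fun w hw => by
    have h1 := (hf.differentiableAt (isOpen_ball.mem_nhds hw)).hasDerivAt
    have h2 := h1.mul (hud w hw).neg.cexp
    refine HasDerivAt.congr_deriv h2 ?_
    rw [Pi.neg_apply, mul_neg, mul_neg, mul_left_comm, mul_div_cancel₀ _ (h0 w hw), mul_comm,
      add_neg_cancel]
  have h := (convex_ball (0 : ℂ) T).is_const_of_fderivWithin_eq_zero (𝕜 := ℂ)
    (f := fun w => f w * exp (-u w))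
    (fun w hw => (hconst w hw).differentiableAt.differentiableWithinAt)
    (fun w hw => by
      rw [fderivWithin_of_isOpen isOpen_ball hw]
      ext
      simpa using (hconst w hw).deriv) hz h0T
  simp only [hu0, exp_neg, exp_log (h0 0 h0T), mul_inv_cancel₀ (h0 0 h0T)] at h
  field_simp at h
  exact h.symm

/-- The Borel–Carathéodory theorem, centred at the point `z₀` where a lower bound is known. -/
theorem norm_sub_le_of_re_le {G : ℂ → ℂ} {T M L : ℝ} {z₀ : ℂ} (hT : 0 < T)
    (hG : DifferentiableOn ℂ G (ball 0 T)) (hM : ∀ z ∈ ball (0 : ℂ) T, (G z).re ≤ M)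
    (hz₀ : ‖z₀‖ ≤ T / 4) (hL : -L ≤ (G z₀).re) (hpos : 0 < M + L) {z : ℂ} (hz : ‖z‖ ≤ T / 4) :
    ‖G z - G z₀‖ ≤ 4 * (M + L) := by
  have hmaps : ∀ w ∈ ball (0 : ℂ) (3 * T / 4), z₀ + w ∈ ball (0 : ℂ) T := fun w hw => by
    rw [mem_ball_zero_iff] at hw ⊢
    linarith [norm_add_le z₀ w]
  have hw : ‖z - z₀‖ ≤ T / 2 := (norm_sub_le _ _).trans (by linarith)
  have h := borelCaratheodory_zero (f := fun w => G (z₀ + w) - G z₀) (z := z - z₀)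
    (R := 3 * T / 4) hpos
    (by
      refine DifferentiableOn.sub_const (hG.comp (by fun_prop) hmaps) _)
    (fun w hw => by
      have := hM _ (hmaps w hw)
      change (G (z₀ + w) - G z₀).re ≤ M + L
      rw [sub_re]; linarith)
    (by positivity) (by rw [mem_ball_zero_iff]; linarith) (by simp)
  simp only [add_sub_cancel] at h
  refine h.trans ?_
  rw [div_le_iff₀ (by linarith)]
  nlinarith

/-! ### The zero-free part of a function of the class -/

theorem norm_sub_le_norm_reflected {T : ℝ} (hT : 0 < T) {a z : ℂ} (ha : ‖a‖ ≤ T) (hz : ‖z‖ ≤ T) :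
    ‖z - a‖ ≤ ‖((T : ℂ) ^ 2 - (starRingEnd ℂ) a * z) / T‖ := by
  rw [norm_div, Complex.norm_real, Real.norm_of_nonneg hT.le, le_div_iff₀ hT]
  refine le_of_sq_le_sq ?_ (norm_nonneg _)
  have h1 : ‖z - a‖ ^ 2 = ‖z‖ ^ 2 + ‖a‖ ^ 2 - 2 * ((starRingEnd ℂ) a * z).re := by
    rw [← normSq_eq_norm_sq, normSq_sub, normSq_eq_norm_sq, normSq_eq_norm_sq, mul_comm z]
  have h2 : ‖(T : ℂ) ^ 2 - (starRingEnd ℂ) a * z‖ ^ 2 =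
      T ^ 4 + ‖a‖ ^ 2 * ‖z‖ ^ 2 - 2 * T ^ 2 * ((starRingEnd ℂ) a * z).re := by
    rw [← normSq_eq_norm_sq, normSq_sub, normSq_eq_norm_sq, normSq_eq_norm_sq, norm_mul, norm_conj,
      ← ofReal_pow, Complex.norm_real, re_ofReal_mul, conj_re, Real.norm_of_nonneg (by positivity)]
    ring
  rw [mul_pow, h1, h2]
  have ha2 : 0 ≤ T ^ 2 - ‖a‖ ^ 2 := sub_nonneg.mpr (pow_le_pow_left₀ (norm_nonneg _) ha 2)
  have hz2 : 0 ≤ T ^ 2 - ‖z‖ ^ 2 := sub_nonneg.mpr (pow_le_pow_left₀ (norm_nonneg _) hz 2)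
  nlinarith [mul_nonneg ha2 hz2]

theorem norm_conj_mul_div_lt_one {T : ℝ} (hT : 0 < T) {a z : ℂ} (ha : ‖a‖ < T) (hz : ‖z‖ < T) :
    ‖(starRingEnd ℂ) a / (T : ℂ) ^ 2 * z‖ < 1 := by
  rw [norm_mul, norm_div, norm_conj, norm_pow, Complex.norm_real, Real.norm_of_nonneg hT.le,
    div_mul_eq_mul_div, div_lt_one (by positivity), sq]
  exact mul_lt_mul'' ha hz (norm_nonneg _) (norm_nonneg _)

theorem reflected_eq {T : ℝ} (hT : 0 < T) (a z : ℂ) :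
    ((T : ℂ) ^ 2 - (starRingEnd ℂ) a * z) / T =
      T * (1 - (starRingEnd ℂ) a / (T : ℂ) ^ 2 * z) := by
  have : (T : ℂ) ≠ 0 := by exact_mod_cast hT.ne'
  field_simp

/-- After the zeros in the disc of radius `T` have been reflected out of it, the logarithm of a
function of the class is `O(T ^ ρ)` on a smaller disc. -/
theorem ClassParams.Mem.exists_log_reflected {P : ClassParams} (hP : P.Admissible) {φ : ℝ}
    {ψ g : ℂ → ℂ} (hψ : P.Mem φ ψ) (hg : Differentiable ℂ g) {Z : Finset ℂ} {m : ℂ → ℕ}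
    (hZ : ∀ z, ψ z = (∏ a ∈ Z, (z - a) ^ m a) * g z) {T : ℝ} (hT : 4 * P.r₁ ≤ T)
    (hZT : ∀ a ∈ Z, ‖a‖ < T) (hg0 : ∀ z ∈ ball (0 : ℂ) T, g z ≠ 0) :
    ∃ (G : ℂ → ℂ) (κ : ℂ), DifferentiableOn ℂ G (ball 0 T) ∧
      (∀ z ∈ ball (0 : ℂ) T, exp (G z) =
        (∏ a ∈ Z, (((T : ℂ) ^ 2 - (starRingEnd ℂ) a * z) / T) ^ m a) * g z) ∧
      ∀ z : ℂ, ‖z‖ ≤ T / 4 →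
        ‖G z - κ‖ ≤ 8 * P.σ * (2 * Real.exp 1) ^ P.ρ * T ^ P.ρ := by
  have hr1 := hP.one_le_r₁
  have hT0 : 0 < T := by linarith
  have hTr : P.r₁ ≤ T := by linarith
  have hC₀ := hP.C₀_pos
  have hσ := hP.σ_pos
  set f : ℂ → ℂ := fun z =>
    (∏ a ∈ Z, (((T : ℂ) ^ 2 - (starRingEnd ℂ) a * z) / T) ^ m a) * g z with hf
  have hfd : Differentiable ℂ f := by fun_prop
  have hf0 : ∀ z ∈ ball (0 : ℂ) T, f z ≠ 0 := fun z hz => by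
    refine mul_ne_zero (Finset.prod_ne_zero_iff.mpr fun a ha => pow_ne_zero _ ?_) (hg0 z hz)
    rw [reflected_eq hT0]
    refine mul_ne_zero (by exact_mod_cast hT0.ne') (one_sub_mul_ne_zero
      (norm_conj_mul_div_lt_one hT0 (hZT a ha) (mem_ball_zero_iff.mp hz)))
  obtain ⟨G, hGd, hG⟩ := exists_log_of_ne_zero hfd.differentiableOn hf0
  set z₀ : ℂ := (P.r₁ : ℂ) * Complex.exp ((φ : ℂ) * Complex.I)
  have hz₀n : ‖z₀‖ = P.r₁ := ClassParams.norm_ray φ (by linarith)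
  refine ⟨G, G z₀, hGd, hG, fun z hz => ?_⟩
  have hM : ∀ z : ℂ, ‖z‖ = T → ‖ψ z‖ ≤ P.C₀ * Real.exp (P.σ * T ^ P.ρ) := fun z hz => by
    have := hψ.growth z (by rw [hz]; exact (ClassParams.r₀_le_r₁ P).trans hTr)
    rwa [hz] at this
  have hGn : ∀ z ∈ ball (0 : ℂ) T, Real.exp (G z).re = ‖f z‖ := fun z hz => by
    rw [← norm_exp, hG z hz]
  have hX : (2 * Real.exp 1 * T) ^ P.ρ = (2 * Real.exp 1) ^ P.ρ * T ^ P.ρ :=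
    Real.mul_rpow (by positivity) hT0.le
  have hmono : T ^ P.ρ ≤ (2 * Real.exp 1 * T) ^ P.ρ := by
    refine Real.rpow_le_rpow hT0.le ?_ hP.ρ_pos.le
    have : (1 : ℝ) ≤ 2 * Real.exp 1 := by linarith [Real.add_one_le_exp (1 : ℝ)]
    nlinarith
  have hre : ∀ z ∈ ball (0 : ℂ) T,
      (G z).re ≤ 2 * P.σ * (2 * Real.exp 1 * T) ^ P.ρ - Real.log 2 := fun z hz => by
    have h1 : ‖f z‖ ≤ P.C₀ * Real.exp (P.σ * T ^ P.ρ) :=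
      norm_mul_prod_le hT0 hg hZ hM (mem_ball_zero_iff.mp hz).le
    rw [← hGn z hz, ← Real.le_log_iff_exp_le (by positivity), Real.log_mul (by positivity)
      (by positivity), Real.log_exp] at h1
    have h2 := hP.log_le hTr
    rw [Real.log_mul (by norm_num) hC₀.ne'] at h2
    nlinarith
  have hz₀T : z₀ ∈ ball (0 : ℂ) T := by rw [mem_ball_zero_iff, hz₀n]; linarith
  have hlow : -Real.log 2 ≤ (G z₀).re := by
    have h1 : ‖ψ z₀‖ ≤ ‖f z₀‖ := by
      rw [hZ, hf, norm_mul, norm_mul, norm_prod, norm_prod]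
      refine mul_le_mul_of_nonneg_right (Finset.prod_le_prod (fun _ _ => norm_nonneg _)
        fun a ha => ?_) (norm_nonneg _)
      rw [norm_pow, norm_pow]
      exact pow_le_pow_left₀ (norm_nonneg _) (norm_sub_le_norm_reflected hT0 (hZT a ha).le
        (mem_ball_zero_iff.mp hz₀T).le) _
    have h2 := hψ.half_le_norm hP le_rfl
    rw [← Real.log_inv, ← Real.log_exp (G z₀).re, hGn z₀ hz₀T]
    refine Real.log_le_log (by norm_num) ?_
    rw [inv_eq_one_div]
    exact h2.trans h1
  have h := norm_sub_le_of_re_le hT0 hGd hre (by rw [hz₀n]; linarith) hlow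
    (by have : 0 < (2 * Real.exp 1 * T) ^ P.ρ := by positivity
        have := mul_pos hσ this
        linarith) hz
  refine h.trans (le_of_eq ?_)
  rw [hX]; ring

/-! ### Interpolation error of the logarithm of the zero-free part -/

theorem norm_rotated_le {r x : ℝ} (hr : 0 ≤ r) {ω w : ℂ} (hω : ‖ω‖ = 1) (hw : ‖w‖ ≤ x) :
    ‖(r : ℂ) * ω * w‖ ≤ r * x := by
  rw [norm_mul, norm_mul, hω, mul_one, Complex.norm_real, Real.norm_of_nonneg hr]
  exact mul_le_mul_of_nonneg_left hw hr

/-- The bound before the passage to the limit: the zeros in `R ≤ ‖a‖ < T` give the first term, while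
their reflections and the remaining zero-free factor give the second one. -/
theorem ClassParams.Mem.norm_interpError_log_le_add {P : ClassParams} (hP : P.Admissible) {φ : ℝ}
    {ψ g : ℂ → ℂ} (hψ : P.Mem φ ψ) (hg : Differentiable ℂ g) {Z : Finset ℂ} {m : ℂ → ℕ}
    {R r : ℝ} {p : ℕ} (hp : 1 ≤ p) (hρ : P.ρ < (p : ℝ) + 1) (hR : P.r₁ ≤ R) (hr : 0 < r)
    (hrR : r * ((p : ℝ) + 1) ^ 2 ≤ p * R)
    (hZ : ∀ z, ψ z = (∏ a ∈ Z, (z - a) ^ m a) * g z) (hZR : ∀ a ∈ Z, ‖a‖ < R)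
    (hg0 : ∀ z ∈ ball (0 : ℂ) R, g z ≠ 0) {u : ℂ → ℂ} (hu : ContinuousOn u (ball 0 R))
    (hug : ∀ z ∈ ball (0 : ℂ) R, exp (u z) = g z) {ω s : ℂ} (hω : ‖ω‖ = 1) (hs : ‖s‖ ≤ 1)
    {T : ℝ} (hT : 8 * R ≤ T) :
    ‖interpError p (fun w => u (r * ω * w)) s‖ ≤
      8 * ((p : ℝ) + 2) * ((p : ℝ) + 1) ^ (p + 1) * r ^ (p + 1) *
        (2 * P.σ * (2 * Real.exp 1) ^ P.ρ * ((p : ℝ) + 1) / ((p : ℝ) + 1 - P.ρ) *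
          R ^ (P.ρ - ((p : ℝ) + 1))) +
      (((p + 2).factorial : ℝ) * 2 ^ (p + 2) * (8 * P.σ * (2 * Real.exp 1) ^ P.ρ) *
          (4 * r) ^ (p + 1) +
        8 * ((p : ℝ) + 2) * ((p : ℝ) + 1) ^ (p + 1) * r ^ (p + 1) *
          (2 * P.σ * (2 * Real.exp 1) ^ P.ρ)) * (T ^ P.ρ / T ^ (p + 1)) := by
  classical
  have hr1 := hP.one_le_r₁
  have hσ := hP.σ_pos
  have hR0 : 0 < R := by linarith
  have hT0 : 0 < T := by linarith
  have hp0 : (0 : ℝ) < p := by exact_mod_cast hp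
  have hrR' : r * ((p : ℝ) + 1) < R := by
    by_contra! h
    nlinarith
  -- the zeros of `g` in the disc of radius `T`
  have hgz₀ : ∃ z, g z ≠ 0 := ⟨0, hg0 0 (mem_ball_self hR0)⟩
  obtain ⟨z₁, hz₁⟩ := hgz₀
  set Z₂ : Finset ℂ := (finite_zeros_inter_ball hg hz₁ T).toFinset with hZ₂
  have hZ₂mem : ∀ a, a ∈ Z₂ ↔ ‖a‖ < T ∧ g a = 0 := fun a => by simp [hZ₂]
  have hZ₂R : ∀ a ∈ Z₂, R ≤ ‖a‖ := fun a ha => by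
    by_contra! h
    exact hg0 a (by simpa using h) ((hZ₂mem a).mp ha).2
  set m₂ : ℂ → ℕ := fun a => analyticOrderNatAt g a with hm₂
  obtain ⟨g₂, hg₂d, hg₂, hg₂Z, -⟩ :=
    exists_eq_prod_mul hg (analyticOrderAt_ne_top_of_entire hg hz₁) Z₂
  change ∀ z, g z = (∏ a ∈ Z₂, (z - a) ^ m₂ a) * g₂ z at hg₂
  have hg₂0 : ∀ z ∈ ball (0 : ℂ) T, g₂ z ≠ 0 := fun z hz => by
    by_cases hzZ : z ∈ Z₂
    · exact hg₂Z z hzZ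
    · intro h0
      exact hzZ ((hZ₂mem z).mpr ⟨by simpa using hz, by rw [hg₂, h0, mul_zero]⟩)
  set m' : ℂ → ℕ := fun a => if ‖a‖ < R then m a else m₂ a with hm'
  have hdisj : Disjoint Z Z₂ := Finset.disjoint_left.mpr fun a h1 h2 =>
    absurd (hZR a h1) (not_lt.mpr (hZ₂R a h2))
  have hZ' : ∀ z, ψ z = (∏ a ∈ Z ∪ Z₂, (z - a) ^ m' a) * g₂ z := fun z => by
    rw [Finset.prod_union hdisj, hZ, hg₂, ← mul_assoc]
    congr 2
    · exact Finset.prod_congr rfl fun a ha => by simp [hm', hZR a ha]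
    · exact Finset.prod_congr rfl fun a ha => by simp [hm', hm₂, not_lt.mpr (hZ₂R a ha)]
  have hZ'T : ∀ a ∈ Z ∪ Z₂, ‖a‖ < T := fun a ha => by
    rcases Finset.mem_union.mp ha with h | h
    · linarith [hZR a h]
    · exact ((hZ₂mem a).mp h).1
  obtain ⟨G, κ, hGd, hGe, hGb⟩ :=
    hψ.exists_log_reflected hP hg₂d hZ' (by linarith) hZ'T hg₂0
  -- an explicit logarithm of `g` on the disc of radius `R`
  set K : ℂ := (∏ a ∈ Z₂, (-a) ^ m₂ a) / ∏ a ∈ Z ∪ Z₂, (T : ℂ) ^ m' a with hK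
  have hZ₂0 : ∀ a ∈ Z₂, a ≠ 0 := fun a ha h => by
    have := hZ₂R a ha
    rw [h, norm_zero] at this
    linarith
  have hTC : (T : ℂ) ≠ 0 := by exact_mod_cast hT0.ne'
  have hK0 : K ≠ 0 := div_ne_zero
    (Finset.prod_ne_zero_iff.mpr fun a ha => pow_ne_zero _ (neg_ne_zero.mpr (hZ₂0 a ha)))
    (Finset.prod_ne_zero_iff.mpr fun a _ => pow_ne_zero _ hTC)
  set v : ℂ → ℂ := fun z => (∑ a ∈ Z₂, (m₂ a : ℂ) * log (1 - a⁻¹ * z)) + G z -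
    (∑ a ∈ Z ∪ Z₂, (m' a : ℂ) * log (1 - (starRingEnd ℂ) a / (T : ℂ) ^ 2 * z)) + log K with hv
  have h1lt : ∀ z ∈ ball (0 : ℂ) R, ∀ a ∈ Z₂, ‖a⁻¹ * z‖ < 1 := fun z hz a ha => by
    have ha' : 0 < ‖a‖ := hR0.trans_le (hZ₂R a ha)
    rw [norm_mul, norm_inv, inv_mul_lt_one₀ ha']
    exact (mem_ball_zero_iff.mp hz).trans_le (hZ₂R a ha)
  have h2lt : ∀ z ∈ ball (0 : ℂ) R, ∀ a ∈ Z ∪ Z₂,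
      ‖(starRingEnd ℂ) a / (T : ℂ) ^ 2 * z‖ < 1 := fun z hz a ha =>
    norm_conj_mul_div_lt_one hT0 (hZ'T a ha) (by have := mem_ball_zero_iff.mp hz; linarith)
  have hRT : ball (0 : ℂ) R ⊆ ball 0 T := ball_subset_ball (by linarith)
  have hvc : ContinuousOn v (ball 0 R) := by
    refine (((continuousOn_finsetSum _ fun a ha => ?_).add (hGd.continuousOn.mono hRT)).sub
      (continuousOn_finsetSum _ fun a ha => ?_)).add continuousOn_const
    · exact continuousOn_const.mul (ContinuousOn.clog (by fun_prop)
        fun z hz => one_sub_mul_mem_slitPlane (h1lt z hz a ha))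
    · exact continuousOn_const.mul (ContinuousOn.clog (by fun_prop)
        fun z hz => one_sub_mul_mem_slitPlane (h2lt z hz a ha))
  have hve : ∀ z ∈ ball (0 : ℂ) R, exp (v z) = g z := fun z hz => by
    simp only [hv, exp_add, exp_sub, exp_sum, exp_nat_mul, exp_log hK0]
    rw [hGe z (hRT hz), hg₂]
    have e1 : ∏ a ∈ Z₂, exp (log (1 - a⁻¹ * z)) ^ m₂ a =
        (∏ a ∈ Z₂, (z - a) ^ m₂ a) / ∏ a ∈ Z₂, (-a) ^ m₂ a := by
      rw [← Finset.prod_div_distrib]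
      refine Finset.prod_congr rfl fun a ha => ?_
      rw [exp_log (one_sub_mul_ne_zero (h1lt z hz a ha)), ← div_pow]
      congr 1
      have := hZ₂0 a ha
      field_simp
      ring
    have e2 : ∏ a ∈ Z ∪ Z₂, (((T : ℂ) ^ 2 - (starRingEnd ℂ) a * z) / T) ^ m' a =
        (∏ a ∈ Z ∪ Z₂, (T : ℂ) ^ m' a) *
          ∏ a ∈ Z ∪ Z₂, exp (log (1 - (starRingEnd ℂ) a / (T : ℂ) ^ 2 * z)) ^ m' a := by
      rw [← Finset.prod_mul_distrib]
      refine Finset.prod_congr rfl fun a ha => ?_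
      rw [exp_log (one_sub_mul_ne_zero (h2lt z hz a ha)), ← mul_pow, reflected_eq hT0]
    have n1 : (∏ a ∈ Z₂, (-a) ^ m₂ a) ≠ 0 :=
      Finset.prod_ne_zero_iff.mpr fun a ha => pow_ne_zero _ (neg_ne_zero.mpr (hZ₂0 a ha))
    have n2 : (∏ a ∈ Z ∪ Z₂, (T : ℂ) ^ m' a) ≠ 0 :=
      Finset.prod_ne_zero_iff.mpr fun a _ => pow_ne_zero _ hTC
    have n3 : (∏ a ∈ Z ∪ Z₂, exp (log (1 - (starRingEnd ℂ) a / (T : ℂ) ^ 2 * z)) ^ m' a) ≠ 0 :=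
      Finset.prod_ne_zero_iff.mpr fun a _ => pow_ne_zero _ (exp_ne_zero _)
    rw [e1, e2, hK]
    generalize (∏ a ∈ Z₂, (-a) ^ m₂ a) = A₁ at n1 ⊢
    generalize (∏ a ∈ Z ∪ Z₂, (T : ℂ) ^ m' a) = A₂ at n2 ⊢
    generalize (∏ a ∈ Z ∪ Z₂,
      exp (log (1 - (starRingEnd ℂ) a / (T : ℂ) ^ 2 * z)) ^ m' a) = A₃ at n3 ⊢
    field_simp
  -- `u` and `v` differ by a constant, which the interpolation error does not see
  have hscale : ∀ w : ℂ, ‖w‖ ≤ (p : ℝ) + 1 → (r : ℂ) * ω * w ∈ ball (0 : ℂ) R := fun w hw => by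
    rw [mem_ball_zero_iff]
    exact (norm_rotated_le hr.le hω hw).trans_lt hrR'
  have hsp : ‖s‖ ≤ (p : ℝ) + 1 := by linarith
  have huv : ∀ z ∈ ball (0 : ℂ) R, u z = v z + (u 0 - v 0) := fun z hz => by
    rw [← sub_eq_sub_of_exp_eq (convex_ball (0 : ℂ) R).isPreconnected hu hvc
      (fun z hz => by rw [hug z hz, hve z hz]) hz (mem_ball_self hR0)]
    ring
  have hEu : interpError p (fun w => u (r * ω * w)) s =
      (∑ a ∈ Z₂, (m₂ a : ℂ) * interpError p (fun w => log (1 - a⁻¹ * (r * ω) * w)) s) +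
      interpError p (fun w => G (r * ω * w) - κ) s -
      ∑ a ∈ Z ∪ Z₂, (m' a : ℂ) *
        interpError p (fun w => log (1 - (starRingEnd ℂ) a / (T : ℂ) ^ 2 * (r * ω) * w)) s := by
    rw [interpError_congr (G := fun w => v (r * ω * w) + (u 0 - v 0))
      (T := {w | ‖w‖ ≤ (p : ℝ) + 1}) (fun w hw => huv _ (hscale w hw)) hsp (norm_node_le p)]
    have hassoc : ∀ c w : ℂ, c * (r * ω * w) = c * (r * ω) * w := fun c w => by ring
    have hκ : interpError p (fun w => G (r * ω * w) - κ) s =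
        interpError p (fun w => G (r * ω * w)) s := by
      rw [interpError_sub, interpError_const, sub_zero]
    simp only [hκ, hv, hassoc]
    rw [interpError_add, interpError_add, interpError_sub, interpError_add, interpError_sub,
      interpError_sum, interpError_sum, interpError_const, interpError_const, interpError_const]
    simp only [interpError_const_mul]
    ring
  rw [hEu]
  -- the zeros in `R ≤ ‖a‖ < T`
  have hωr : ‖(r : ℂ) * ω‖ = r := by
    rw [norm_mul, hω, mul_one, Complex.norm_real, Real.norm_of_nonneg hr.le]
  set D : ℝ := 8 * ((p : ℝ) + 2) * ((p : ℝ) + 1) ^ (p + 1) with hD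
  have hD0 : 0 < D := by positivity
  have b1 : ‖∑ a ∈ Z₂, (m₂ a : ℂ) * interpError p (fun w => log (1 - a⁻¹ * (r * ω) * w)) s‖ ≤
      D * r ^ (p + 1) * (2 * P.σ * (2 * Real.exp 1) ^ P.ρ * ((p : ℝ) + 1) / ((p : ℝ) + 1 - P.ρ) *
          R ^ (P.ρ - ((p : ℝ) + 1))) := by
    have hsum := sum_mul_norm_rpow_neg_le (w := fun a => (m₂ a : ℝ)) hR0 hP.ρ_pos hρ hZ₂R
      (fun _ _ => Nat.cast_nonneg _) (fun t ht => hψ.sum_multiplicity_le hP (Z := Z₂)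
        (g := fun z => (∏ a ∈ Z, (z - a) ^ m a) * g₂ z) (by fun_prop)
        (fun z => by rw [hZ, hg₂]; ring) (hR.trans ht))
    refine (norm_sum_le _ _).trans ?_
    refine le_trans (Finset.sum_le_sum (g := fun a => D * r ^ (p + 1) *
      ((m₂ a : ℝ) * ‖a‖ ^ (-((p : ℝ) + 1)))) fun a ha => ?_) ?_
    · have ha0 : 0 < ‖a‖ := hR0.trans_le (hZ₂R a ha)
      have hn : ‖a⁻¹ * (r * ω)‖ = r / ‖a‖ := by
        rw [norm_mul, norm_inv, hωr]; field_simp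
      have h := norm_interpError_log_le hp (c := a⁻¹ * (r * ω)) (s := s)
        (by rw [hn, div_mul_eq_mul_div, div_le_iff₀ ha0]
            exact hrR.trans (mul_le_mul_of_nonneg_left (hZ₂R a ha) hp0.le)) hs
      rw [norm_mul, Complex.norm_natCast]
      rw [hn, ← hD] at h
      refine (mul_le_mul_of_nonneg_left h (Nat.cast_nonneg _)).trans (le_of_eq ?_)
      have : ‖a‖ ^ (-((p : ℝ) + 1)) = (‖a‖ ^ (p + 1))⁻¹ := by
        rw [Real.rpow_neg ha0.le, ← Real.rpow_natCast]; push_cast; rfl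
      rw [this, div_pow]
      ring
    · rw [← Finset.mul_sum]
      exact mul_le_mul_of_nonneg_left hsum (by positivity)
  -- the zero-free factor
  have b2 : ‖interpError p (fun w => G (r * ω * w) - κ) s‖ ≤
      ((p + 2).factorial : ℝ) * 2 ^ (p + 2) * (8 * P.σ * (2 * Real.exp 1) ^ P.ρ) *
          (4 * r) ^ (p + 1) * (T ^ P.ρ / T ^ (p + 1)) := by
    have hϱ : 2 * ((p : ℝ) + 1) ≤ T / (4 * r) := by
      rw [le_div_iff₀ (by positivity)]; nlinarith
    have hϱ0 : 0 < T / (4 * r) := by positivity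
    have hmap : ∀ w : ℂ, ‖w‖ ≤ T / (4 * r) → ‖(r : ℂ) * ω * w‖ ≤ T / 4 := fun w hw => by
      refine (norm_rotated_le hr.le hω hw).trans (le_of_eq ?_)
      field_simp
    have hdiff : DiffContOnCl ℂ (fun w => G (r * ω * w) - κ) (ball 0 (T / (4 * r))) := by
      refine DifferentiableOn.diffContOnCl ?_
      rw [closure_ball _ hϱ0.ne']
      refine DifferentiableOn.sub_const (hGd.comp (by fun_prop) fun w hw => ?_) _
      rw [mem_ball_zero_iff]
      linarith [hmap w (by simpa using hw)]
    have h := norm_interpError_le_of_diffContOnCl hϱ hdiff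
      (fun w hw => hGb _ (hmap w (by simpa using (mem_sphere_zero_iff_norm.mp hw).le))) hs
    refine h.trans (le_of_eq ?_)
    rw [div_pow]
    field_simp
  -- the reflected zeros
  have b3 : ‖∑ a ∈ Z ∪ Z₂, (m' a : ℂ) *
        interpError p (fun w => log (1 - (starRingEnd ℂ) a / (T : ℂ) ^ 2 * (r * ω) * w)) s‖ ≤
      D * r ^ (p + 1) * (2 * P.σ * (2 * Real.exp 1) ^ P.ρ) * (T ^ P.ρ / T ^ (p + 1)) := by
    have hcount := hψ.sum_multiplicity_le hP hg₂d hZ' (t := T) (by linarith)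
    rw [Finset.filter_true_of_mem fun a ha => (hZ'T a ha).le] at hcount
    refine (norm_sum_le _ _).trans ?_
    refine le_trans (Finset.sum_le_sum (g := fun a => (m' a : ℝ) * (D * (r / T) ^ (p + 1)))
      fun a ha => ?_) ?_
    · have haT := hZ'T a ha
      have hn : ‖(starRingEnd ℂ) a / (T : ℂ) ^ 2 * (r * ω)‖ ≤ r / T := by
        rw [norm_mul, norm_div, norm_conj, hωr, norm_pow, Complex.norm_real,
          Real.norm_of_nonneg hT0.le, div_mul_eq_mul_div, div_le_div_iff₀ (by positivity) hT0]
        have := mul_le_mul_of_nonneg_right haT.le (mul_pos hr hT0).le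
        nlinarith
      have h := norm_interpError_log_le hp (c := (starRingEnd ℂ) a / (T : ℂ) ^ 2 * (r * ω)) (s := s)
        (by refine (mul_le_mul_of_nonneg_right hn (by positivity)).trans ?_
            rw [div_mul_eq_mul_div, div_le_iff₀ hT0]
            exact hrR.trans (mul_le_mul_of_nonneg_left (by linarith) hp0.le)) hs
      rw [norm_mul, Complex.norm_natCast]
      refine mul_le_mul_of_nonneg_left (h.trans ?_) (Nat.cast_nonneg _)
      exact mul_le_mul_of_nonneg_left (pow_le_pow_left₀ (norm_nonneg _) hn _) hD0.le
    · rw [← Finset.sum_mul]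
      refine (mul_le_mul_of_nonneg_right hcount (by positivity)).trans (le_of_eq ?_)
      rw [div_pow]
      ring
  refine (norm_sub_le _ _).trans ?_
  have := norm_add_le (∑ a ∈ Z₂, (m₂ a : ℂ) *
    interpError p (fun w => log (1 - a⁻¹ * (r * ω) * w)) s)
    (interpError p (fun w => G (r * ω * w) - κ) s)
  rw [add_mul]
  linarith

theorem tendsto_rpow_div_pow {ρ : ℝ} {n : ℕ} (h : ρ < n) :
    Tendsto (fun T : ℝ => T ^ ρ / T ^ n) atTop (𝓝 0) := by
  have h1 := tendsto_rpow_neg_atTop (y := (n : ℝ) - ρ) (by linarith)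
  refine h1.congr' ?_
  filter_upwards [eventually_gt_atTop 0] with T hT
  rw [neg_sub, Real.rpow_sub hT, Real.rpow_natCast]

/-- Letting `T → ∞` replaces the Hadamard factorisation: since `p + 1` exceeds the order `ρ`, only
the zeros of `ψ` outside the disc of radius `R` contribute. -/
theorem ClassParams.Mem.norm_interpError_log_le {P : ClassParams} (hP : P.Admissible) {φ : ℝ}
    {ψ g : ℂ → ℂ} (hψ : P.Mem φ ψ) (hg : Differentiable ℂ g) {Z : Finset ℂ} {m : ℂ → ℕ}
    {R r : ℝ} {p : ℕ} (hp : 1 ≤ p) (hρ : P.ρ < (p : ℝ) + 1) (hR : P.r₁ ≤ R) (hr : 0 < r)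
    (hrR : r * ((p : ℝ) + 1) ^ 2 ≤ p * R)
    (hZ : ∀ z, ψ z = (∏ a ∈ Z, (z - a) ^ m a) * g z) (hZR : ∀ a ∈ Z, ‖a‖ < R)
    (hg0 : ∀ z ∈ ball (0 : ℂ) R, g z ≠ 0) {u : ℂ → ℂ} (hu : ContinuousOn u (ball 0 R))
    (hug : ∀ z ∈ ball (0 : ℂ) R, exp (u z) = g z) {ω s : ℂ} (hω : ‖ω‖ = 1) (hs : ‖s‖ ≤ 1) :
    ‖interpError p (fun w => u (r * ω * w)) s‖ ≤
      8 * ((p : ℝ) + 2) * ((p : ℝ) + 1) ^ (p + 1) * r ^ (p + 1) *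
        (2 * P.σ * (2 * Real.exp 1) ^ P.ρ * ((p : ℝ) + 1) / ((p : ℝ) + 1 - P.ρ) *
          R ^ (P.ρ - ((p : ℝ) + 1))) := by
  have hlim := ((tendsto_rpow_div_pow (ρ := P.ρ) (n := p + 1) (by push_cast; exact hρ)).const_mul
    (((p + 2).factorial : ℝ) * 2 ^ (p + 2) * (8 * P.σ * (2 * Real.exp 1) ^ P.ρ) *
          (4 * r) ^ (p + 1) +
        8 * ((p : ℝ) + 2) * ((p : ℝ) + 1) ^ (p + 1) * r ^ (p + 1) *
          (2 * P.σ * (2 * Real.exp 1) ^ P.ρ))).const_add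
    (8 * ((p : ℝ) + 2) * ((p : ℝ) + 1) ^ (p + 1) * r ^ (p + 1) *
        (2 * P.σ * (2 * Real.exp 1) ^ P.ρ * ((p : ℝ) + 1) / ((p : ℝ) + 1 - P.ρ) *
          R ^ (P.ρ - ((p : ℝ) + 1))))
  rw [mul_zero, add_zero] at hlim
  refine ge_of_tendsto hlim ?_
  filter_upwards [eventually_ge_atTop (8 * R)] with T hT
  exact hψ.norm_interpError_log_le_add hP hg hp hρ hR hr hrR hZ hZR hg0 hu hug hω hs hT

/-! ### Comparison of two functions of the class -/

namespace ClassParams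

theorem p_spec {P : ClassParams} {δ : ℝ} (hδ : 0 < δ) :
    1 ≤ P.p δ ∧ P.μ ≤ δ * ((P.p δ : ℝ) + 1) - P.ρ := by
  have hne : {n : ℕ | 1 ≤ n ∧ P.μ ≤ δ * ((n : ℝ) + 1) - P.ρ}.Nonempty := by
    obtain ⟨n, hn⟩ := exists_nat_ge ((P.μ + P.ρ) / δ)
    refine ⟨n + 1, by omega, ?_⟩
    rw [div_le_iff₀ hδ] at hn
    push_cast
    nlinarith
  exact Nat.sInf_mem hne

/-- The common zeros in the disc can be divided out simultaneously. -/
theorem Mem.exists_common_factor {P : ClassParams} (hP : P.Admissible) {φ : ℝ} {ψ₁ ψ₂ : ℂ → ℂ}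
    (hψ₁ : P.Mem φ ψ₁) (hψ₂ : P.Mem φ ψ₂) {R : ℝ} (hzeros : SameZeros ψ₁ ψ₂ R) :
    ∃ (Z : Finset ℂ) (m : ℂ → ℕ) (g₁ g₂ : ℂ → ℂ), Differentiable ℂ g₁ ∧ Differentiable ℂ g₂ ∧
      (∀ a ∈ Z, ‖a‖ < R) ∧
      (∀ z, ψ₁ z = (∏ a ∈ Z, (z - a) ^ m a) * g₁ z) ∧
      (∀ z, ψ₂ z = (∏ a ∈ Z, (z - a) ^ m a) * g₂ z) ∧
      (∀ z ∈ ball (0 : ℂ) R, g₁ z ≠ 0) ∧ ∀ z ∈ ball (0 : ℂ) R, g₂ z ≠ 0 := by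
  have hne : ∀ ψ : ℂ → ℂ, P.Mem φ ψ → ∃ z, ψ z ≠ 0 := fun ψ hψ =>
    ⟨_, fun h0 => by
      have := hψ.half_le_norm hP le_rfl
      rw [h0, norm_zero] at this
      norm_num at this⟩
  obtain ⟨z₁, hz₁⟩ := hne ψ₁ hψ₁
  obtain ⟨z₂, hz₂⟩ := hne ψ₂ hψ₂
  set Z : Finset ℂ := (finite_zeros_inter_ball hψ₁.entire hz₁ R).toFinset with hZ
  have hZmem : ∀ a, a ∈ Z ↔ ‖a‖ < R ∧ ψ₁ a = 0 := fun a => by simp [hZ]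
  obtain ⟨g₁, hg₁d, hg₁, hg₁Z, hg₁o⟩ :=
    exists_eq_prod_mul hψ₁.entire (analyticOrderAt_ne_top_of_entire hψ₁.entire hz₁) Z
  obtain ⟨g₂, hg₂d, hg₂, hg₂Z, hg₂o⟩ :=
    exists_eq_prod_mul hψ₂.entire (analyticOrderAt_ne_top_of_entire hψ₂.entire hz₂) Z
  have hout : ∀ z ∈ ball (0 : ℂ) R, z ∉ Z → analyticOrderAt ψ₁ z = 0 := fun z hz hzZ => by
    rw [(hψ₁.entire.analyticAt z).analyticOrderAt_eq_zero]
    exact fun h => hzZ ((hZmem z).mpr ⟨by simpa using hz, h⟩)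
  refine ⟨Z, fun a => analyticOrderNatAt ψ₁ a, g₁, g₂, hg₁d, hg₂d,
    fun a ha => ((hZmem a).mp ha).1, hg₁, fun z => ?_, fun z hz => ?_, fun z hz => ?_⟩
  · rw [hg₂]
    congr 1
    refine Finset.prod_congr rfl fun a ha => ?_
    change (z - a) ^ (analyticOrderAt ψ₂ a).toNat = (z - a) ^ (analyticOrderAt ψ₁ a).toNat
    rw [hzeros a (by simpa using ((hZmem a).mp ha).1)]
  · by_cases hzZ : z ∈ Z
    · exact hg₁Z z hzZ
    · rw [← (hg₁d.analyticAt z).analyticOrderAt_eq_zero, hg₁o z hzZ, hout z hz hzZ]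
  · by_cases hzZ : z ∈ Z
    · exact hg₂Z z hzZ
    · rw [← (hg₂d.analyticAt z).analyticOrderAt_eq_zero, hg₂o z hzZ, ← hzeros z hz,
        hout z hz hzZ]

theorem le_rpow_of_rpow_one_div_le {a b R : ℝ} (ha : 0 ≤ a) (hb : 0 < b)
    (h : a ^ (1 / b) ≤ R) : a ≤ R ^ b := by
  have := Real.rpow_le_rpow (by positivity) h hb.le
  rwa [← Real.rpow_mul ha, one_div_mul_cancel hb.ne', Real.rpow_one] at this

theorem C₂_pos {P : ClassParams} (hP : P.Admissible) {δ : ℝ}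
    (hρ : P.ρ < (P.p δ : ℝ) + 1) : 0 < P.C₂ δ := by
  have hσ := hP.σ_pos
  exact div_pos (by positivity) (by linarith)

theorem norm_log_div_le {a b : ℂ} {y : ℝ} (ha : ‖a - 1‖ ≤ y) (hb : ‖b - 1‖ ≤ y)
    (hy : y ≤ 1 / 100) : ‖b / a - 1‖ ≤ 1 / 2 ∧ ‖log (b / a)‖ ≤ 31 / 10 * y := by
  have hy0 : 0 ≤ y := (norm_nonneg _).trans ha
  have ha' : 99 / 100 ≤ ‖a‖ := by
    have := norm_sub_norm_le (1 : ℂ) (1 - a)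
    rw [sub_sub_cancel, norm_one, norm_sub_rev] at this
    linarith
  have ha0 : a ≠ 0 := fun h => by rw [h, norm_zero] at ha'; norm_num at ha'
  have h1 : ‖b / a - 1‖ ≤ 203 / 100 * y := by
    rw [div_sub_one ha0, norm_div, div_le_iff₀ (by linarith)]
    have : ‖b - a‖ ≤ y + y := by
      rw [← sub_sub_sub_cancel_right b a 1]
      exact (norm_sub_le _ _).trans (add_le_add hb ha)
    nlinarith
  have h2 : ‖b / a - 1‖ ≤ 1 / 2 := by linarith
  refine ⟨h2, ?_⟩
  have h3 := norm_log_one_add_half_le_self h2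
  rw [add_sub_cancel] at h3
  linarith

/-- The tail of the zero distribution, in units of `C₁ / R ^ (μ (1 - δ))`. -/
theorem tail_le {P : ClassParams} (hP : P.Admissible) {δ : ℝ} (hδ : δ ∈ Set.Ioo (0 : ℝ) 1) {R : ℝ}
    (hρ : P.ρ < (P.p δ : ℝ) + 1) (hR1 : 1 ≤ R) (hR : P.r₅ δ ≤ R) :
    ((P.p δ : ℝ) + 1) ^ (P.p δ + 1) * (R ^ (1 - δ)) ^ (P.p δ + 1) *
      (P.C₂ δ * R ^ (P.ρ - ((P.p δ : ℝ) + 1))) ≤ P.C₁ / R ^ (P.μ * (1 - δ)) / 2 := by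
  have hC₁ := hP.C₁_pos
  have hμ := hP.μ_pos
  have hδ0 : 0 < δ := hδ.1
  have hR0 : 0 < R := by linarith
  have hC₂ := C₂_pos hP hρ
  have h5 : 2 * ((P.p δ : ℝ) + 1) ^ (P.p δ + 1) * (P.C₂ δ / P.C₁) ≤ R ^ (P.μ * δ) :=
    le_rpow_of_rpow_one_div_le (by positivity) (by positivity) hR
  rw [mul_div_assoc', div_le_iff₀ hC₁] at h5
  have e1 : (R ^ (1 - δ)) ^ (P.p δ + 1) * R ^ (P.ρ - ((P.p δ : ℝ) + 1)) ≤ R ^ (-P.μ) := by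
    rw [← Real.rpow_natCast, ← Real.rpow_mul hR0.le, ← Real.rpow_add hR0]
    refine Real.rpow_le_rpow_of_exponent_le hR1 ?_
    have := (p_spec (P := P) hδ0).2
    push_cast
    linarith
  have e2 : R ^ (P.μ * δ) * R ^ (-P.μ) = (R ^ (P.μ * (1 - δ)))⁻¹ := by
    rw [← Real.rpow_add hR0, ← Real.rpow_neg hR0.le]
    congr 1
    ring
  calc _ = (((P.p δ : ℝ) + 1) ^ (P.p δ + 1) * P.C₂ δ) *
        ((R ^ (1 - δ)) ^ (P.p δ + 1) * R ^ (P.ρ - ((P.p δ : ℝ) + 1))) := by ring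
    _ ≤ (R ^ (P.μ * δ) * P.C₁ / 2) * R ^ (-P.μ) := by
        refine mul_le_mul (by linarith) e1 (by positivity) (by positivity)
    _ = P.C₁ * (R ^ (P.μ * δ) * R ^ (-P.μ)) / 2 := by ring
    _ = _ := by rw [e2]; ring

/-- The consequences of `R ≥ threshold` for the radius `R ^ (1 - δ)` of the small disc. -/
theorem radius_spec {P : ClassParams} (hP : P.Admissible) {δ : ℝ} (hδ : δ ∈ Set.Ioo (0 : ℝ) 1)
    {R : ℝ} (hR1 : 1 ≤ R) (hR₂ : P.r₂ δ ≤ R) (hR₄ : P.r₄ δ ≤ R) :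
    P.r₀ ≤ R ^ (1 - δ) ∧ R ^ (1 - δ) * ((P.p δ : ℝ) + 1) ^ 2 ≤ P.p δ * R ∧
      P.A (P.p δ) * (P.C₁ / R ^ (P.μ * (1 - δ))) ≤ 1 / 36 := by
  have hδ0 : 0 < δ := hδ.1
  have hδ1 : 0 < 1 - δ := sub_pos.mpr hδ.2
  have hR0 : 0 < R := by linarith
  have hC₁ := hP.C₁_pos
  have hμ := hP.μ_pos
  have hp := (p_spec (P := P) hδ0).1
  have hp0 : (0 : ℝ) < (P.p δ : ℝ) := by exact_mod_cast hp
  have hA0 := A_pos P hp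
  refine ⟨le_rpow_of_rpow_one_div_le (by linarith [hP.one_le_r₀]) hδ1
    ((le_max_left _ _).trans hR₄), ?_, ?_⟩
  · have h : ((P.p δ : ℝ) + 1) * ((P.p δ : ℝ) + 1) / (P.p δ : ℝ) ≤ R ^ δ :=
      le_rpow_of_rpow_one_div_le (by positivity) hδ0
        (((le_max_left _ _).trans (le_max_right _ _)).trans hR₂)
    rw [div_le_iff₀ hp0] at h
    have hprod : R ^ (1 - δ) * R ^ δ = R := by
      rw [← Real.rpow_add hR0, sub_add_cancel, Real.rpow_one]
    have h2 := mul_le_mul_of_nonneg_left h (show 0 ≤ R ^ (1 - δ) by positivity)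
    rw [← mul_assoc (R ^ (1 - δ)) (R ^ δ), hprod] at h2
    rw [sq]
    linarith
  · have h := le_rpow_of_rpow_one_div_le (a := 36 * P.C₁ * P.A (P.p δ)) (b := P.μ * (1 - δ))
      (by positivity) (by positivity) ((le_max_right _ _).trans hR₄)
    rw [mul_div_assoc', div_le_iff₀ (by positivity)]
    linarith

/-- The quotient of two functions of the class is close to `1` on the ray. -/
theorem Mem.norm_log_quotient_le {P : ClassParams} (hP : P.Admissible) {φ : ℝ} {ψ₁ ψ₂ : ℂ → ℂ}
    (hψ₁ : P.Mem φ ψ₁) (hψ₂ : P.Mem φ ψ₂) {r t : ℝ} (hr : P.r₀ ≤ r) (ht : 1 ≤ t)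
    (hx : P.C₁ / r ^ P.μ ≤ 1 / 100) {z : ℂ}
    (hz : z = (r : ℂ) * Complex.exp ((φ : ℂ) * Complex.I) * t) :
    ψ₁ z ≠ 0 ∧ ‖ψ₂ z / ψ₁ z - 1‖ ≤ 1 / 2 ∧
      ‖log (ψ₂ z / ψ₁ z)‖ ≤ 31 / 10 * (P.C₁ / r ^ P.μ * t ^ (-P.μ)) := by
  have hr0 : 0 < r := one_pos.trans_le (hP.one_le_r₀.trans hr)
  have ht0 : 0 < t := by linarith
  have hC₁ := hP.C₁_pos
  have hμ := hP.μ_pos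
  have hpt : z = ((r * t : ℝ) : ℂ) * Complex.exp ((φ : ℂ) * Complex.I) := by
    rw [hz]; push_cast; ring
  have hrt : P.r₀ ≤ r * t := hr.trans (le_mul_of_one_le_right hr0.le ht)
  have hval : P.C₁ / (r * t) ^ P.μ = P.C₁ / r ^ P.μ * t ^ (-P.μ) := by
    rw [Real.mul_rpow hr0.le ht0.le, Real.rpow_neg ht0.le]
    field_simp
  have hy : P.C₁ / r ^ P.μ * t ^ (-P.μ) ≤ 1 / 100 := by
    have h1 : t ^ (-P.μ) ≤ 1 := Real.rpow_le_one_of_one_le_of_nonpos ht (by linarith)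
    exact (mul_le_of_le_one_right (by positivity) h1).trans hx
  have e₁ := hψ₁.ray (r * t) hrt
  have e₂ := hψ₂.ray (r * t) hrt
  rw [hval, ← hpt] at e₁ e₂
  refine ⟨fun h => ?_, norm_log_div_le e₁ e₂ hy⟩
  rw [h, zero_sub, norm_neg, norm_one] at e₁
  linarith

end ClassParams

/-- A continuous logarithm of a function that stays close to `1` on a preconnected set is a constant
translate of the principal one. -/
theorem exists_sub_eq_log {X : Type*} [TopologicalSpace X] {S : Set X} (hS : IsPreconnected S)
    (hne : S.Nonempty) {u q : X → ℂ} (hu : ContinuousOn u S) (hq : ContinuousOn q S)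
    (hexp : ∀ t ∈ S, exp (u t) = q t) (hclose : ∀ t ∈ S, ‖q t - 1‖ ≤ 1 / 2) :
    ∃ κ : ℂ, exp κ = 1 ∧ ∀ t ∈ S, u t - κ = log (q t) := by
  obtain ⟨t₀, ht₀⟩ := hne
  have hslit : ∀ t ∈ S, q t ∈ slitPlane := fun t ht => by
    have h := mem_slitPlane_of_norm_lt_one (z := q t - 1) (by linarith [hclose t ht])
    rwa [add_sub_cancel] at h
  have hlog : ∀ t ∈ S, exp (log (q t)) = q t := fun t ht => exp_log (slitPlane_ne_zero (hslit t ht))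
  refine ⟨u t₀ - log (q t₀), ?_, fun t ht => ?_⟩
  · rw [exp_sub, hexp t₀ ht₀, hlog t₀ ht₀, div_self (slitPlane_ne_zero (hslit t₀ ht₀))]
  · rw [← sub_eq_sub_of_exp_eq hS hu (v := fun t => log (q t)) (hq.clog hslit)
      (fun t ht => by rw [hexp t ht, hlog t ht]) ht ht₀, sub_sub_cancel]

namespace ClassParams

/-- The quotient of the zero-free parts is the exponential of a function whose values at the nodes
`k R ^ (1 - δ) e ^ (iφ)` are controlled by the behaviour on the ray, and whose interpolation error
is controlled by the zeros outside the disc of radius `R`. -/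
theorem Mem.norm_div_sub_one_lt {P : ClassParams} (hP : P.Admissible) {δ : ℝ}
    (hδ : δ ∈ Set.Ioo (0 : ℝ) 1) {φ : ℝ} {ψ₁ ψ₂ g₁ g₂ : ℂ → ℂ} (hψ₁ : P.Mem φ ψ₁)
    (hψ₂ : P.Mem φ ψ₂) {R : ℝ} (hR : P.threshold δ ≤ R) {Z : Finset ℂ} {m : ℂ → ℕ}
    (hg₁ : Differentiable ℂ g₁) (hg₂ : Differentiable ℂ g₂) (hZ : ∀ a ∈ Z, ‖a‖ < R)
    (hf₁ : ∀ z, ψ₁ z = (∏ a ∈ Z, (z - a) ^ m a) * g₁ z)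
    (hf₂ : ∀ z, ψ₂ z = (∏ a ∈ Z, (z - a) ^ m a) * g₂ z)
    (h₁0 : ∀ z ∈ ball (0 : ℂ) R, g₁ z ≠ 0) (h₂0 : ∀ z ∈ ball (0 : ℂ) R, g₂ z ≠ 0)
    {z : ℂ} (hz : z ∈ ball (0 : ℂ) (R ^ (1 - δ))) :
    ‖g₂ z / g₁ z - 1‖ < P.C δ / R ^ (P.μ * (1 - δ)) := by
  have hC₁ := hP.C₁_pos
  have hμ := hP.μ_pos
  simp only [threshold, max_le_iff] at hR
  obtain ⟨hR₁, hR₂, -, hR₄, hR₅⟩ := hR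
  have hR1 : 1 ≤ R := hP.one_le_r₁.trans hR₁
  have hR0 : 0 < R := by linarith
  obtain ⟨hp, hpμ⟩ := p_spec (P := P) hδ.1
  have hp1 : (1 : ℝ) ≤ (P.p δ : ℝ) := by exact_mod_cast hp
  have hρ : P.ρ < (P.p δ : ℝ) + 1 := by nlinarith [hδ.2]
  have htail := tail_le hP hδ hρ hR1 hR₅
  obtain ⟨hrr₀, hrR, hxA⟩ := radius_spec hP hδ hR1 hR₂ hR₄
  have hA := add_two_le_A P hp
  have hA0 := A_pos P hp
  have hC₂def : P.C₂ δ = 2 * P.σ * (2 * Real.exp 1) ^ P.ρ * ((P.p δ : ℝ) + 1) /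
      ((P.p δ : ℝ) + 1 - P.ρ) := by rw [C₂]; ring
  have hCdef : P.C δ = 20 * P.A (P.p δ) * P.C₁ := rfl
  have hr0 : 0 < R ^ (1 - δ) := by positivity
  have hrμ : R ^ (P.μ * (1 - δ)) = (R ^ (1 - δ)) ^ P.μ := by
    rw [← Real.rpow_mul hR0.le, mul_comm]
  rw [hrμ] at htail hxA ⊢
  rw [hCdef, mul_div_assoc]
  generalize R ^ (1 - δ) = r at *
  have hx0 : 0 < P.C₁ / r ^ P.μ := by positivity
  have hray := fun t ht hx => hψ₁.norm_log_quotient_le hP hψ₂ (t := t) hrr₀ ht hx rfl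
  generalize P.C₁ / r ^ P.μ = x at *
  have hsumA := fun s hs => sum_norm_lagrangeWeight_le P (P.p δ) (s := s) hs
  generalize P.A (P.p δ) = A at *
  have hx100 : x ≤ 1 / 100 := by nlinarith
  -- logarithms of the zero-free parts
  obtain ⟨u₁, hu₁d, hu₁⟩ := exists_log_of_ne_zero hg₁.differentiableOn h₁0
  obtain ⟨u₂, hu₂d, hu₂⟩ := exists_log_of_ne_zero hg₂.differentiableOn h₂0
  set ω : ℂ := Complex.exp ((φ : ℂ) * Complex.I) with hωdef
  have hω : ‖ω‖ = 1 := norm_exp_ofReal_mul_I φ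
  have hω0 : ω ≠ 0 := exp_ne_zero _
  have hrC : (r : ℂ) ≠ 0 := by exact_mod_cast hr0.ne'
  have hscale : ∀ w : ℂ, ‖w‖ ≤ (P.p δ : ℝ) + 1 → (r : ℂ) * ω * w ∈ ball (0 : ℂ) R := fun w hw => by
    rw [mem_ball_zero_iff]
    refine (norm_rotated_le hr0.le hω hw).trans_lt ?_
    by_contra! h
    nlinarith
  have hquot : ∀ w : ℂ, ‖w‖ ≤ (P.p δ : ℝ) + 1 →
      exp (u₂ (r * ω * w) - u₁ (r * ω * w)) = g₂ (r * ω * w) / g₁ (r * ω * w) := fun w hw => by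
    rw [exp_sub, hu₁ _ (hscale w hw), hu₂ _ (hscale w hw)]
  have hq : ∀ t : ℝ, 1 ≤ t → ψ₂ (r * ω * t) / ψ₁ (r * ω * t) =
      g₂ (r * ω * t) / g₁ (r * ω * t) := fun t ht => by
    have hne := (hray t ht hx100).1
    rw [hf₁] at hne
    rw [hf₁, hf₂, mul_div_mul_left _ _ (left_ne_zero_of_mul hne)]
  -- the branch of the logarithm of the quotient is the principal one along the whole segment
  have hnorm : ∀ t ∈ Set.Icc (1 : ℝ) ((P.p δ : ℝ) + 1), ‖(t : ℂ)‖ ≤ (P.p δ : ℝ) + 1 :=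
    fun t ht => by
      rw [Complex.norm_real, Real.norm_of_nonneg (by linarith [ht.1])]
      exact ht.2
  have hmaps : Set.MapsTo (fun t : ℝ => (r : ℂ) * ω * t) (Set.Icc (1 : ℝ) ((P.p δ : ℝ) + 1))
      (ball 0 R) := fun t ht => hscale _ (hnorm t ht)
  have hc : ContinuousOn (fun t : ℝ => (r : ℂ) * ω * t)
      (Set.Icc (1 : ℝ) ((P.p δ : ℝ) + 1)) := by fun_prop
  obtain ⟨κ, hκ1, hκ⟩ := exists_sub_eq_log (X := ℝ) (S := Set.Icc (1 : ℝ) ((P.p δ : ℝ) + 1))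
    (u := fun t => u₂ (r * ω * t) - u₁ (r * ω * t))
    (q := fun t => g₂ (r * ω * t) / g₁ (r * ω * t))
    isPreconnected_Icc ⟨1, le_rfl, by linarith⟩
    ((hu₂d.continuousOn.comp hc hmaps).sub (hu₁d.continuousOn.comp hc hmaps))
    ((hg₂.continuous.comp_continuousOn hc).div (hg₁.continuous.comp_continuousOn hc)
      fun t ht => h₁0 _ (hmaps ht))
    (fun t ht => hquot _ (hnorm t ht))
    (fun t ht => by rw [← hq t ht.1]; exact (hray t ht.1 hx100).2.1)
  set h : ℂ → ℂ := fun w => u₂ (r * ω * w) - u₁ (r * ω * w) - κ with hh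
  -- the bound for `h` on the unit disc
  set s : ℂ := z / (r * ω) with hs
  have hzs : (r : ℂ) * ω * s = z := by rw [hs]; field_simp
  have hs1 : ‖s‖ ≤ 1 := by
    rw [hs, norm_div, norm_mul, hω, mul_one, Complex.norm_real, Real.norm_of_nonneg hr0.le,
      div_le_one hr0]
    exact (mem_ball_zero_iff.mp hz).le
  have hEi : ‖interpError (P.p δ) h s‖ ≤ 8 * (A * x) := by
    have b₁ := hψ₁.norm_interpError_log_le hP hg₁ hp hρ hR₁ hr0 hrR hf₁ hZ h₁0
      hu₁d.continuousOn hu₁ hω hs1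
    have b₂ := hψ₂.norm_interpError_log_le hP hg₂ hp hρ hR₁ hr0 hrR hf₂ hZ h₂0
      hu₂d.continuousOn hu₂ hω hs1
    rw [← hC₂def] at b₁ b₂
    have hE : interpError (P.p δ) h s = interpError (P.p δ) (fun w => u₂ (r * ω * w)) s -
        interpError (P.p δ) (fun w => u₁ (r * ω * w)) s := by
      rw [hh, interpError_sub, interpError_sub, interpError_const, sub_zero]
    rw [hE]
    have h3 := norm_sub_le (interpError (P.p δ) (fun w => u₂ (r * ω * w)) s)
      (interpError (P.p δ) (fun w => u₁ (r * ω * w)) s)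
    have h4 := mul_le_mul_of_nonneg_left htail
      (show (0 : ℝ) ≤ 8 * ((P.p δ : ℝ) + 2) by positivity)
    have h5 := mul_le_mul_of_nonneg_right hA hx0.le
    rw [← mul_assoc, ← mul_assoc] at h4
    linarith
  have hnodes : ‖∑ k : Fin (P.p δ + 1), lagrangeWeight (P.p δ) k s * h ((k : ℂ) + 1)‖ ≤
      31 / 10 * (A * x) := by
    refine (norm_sum_le _ _).trans ?_
    refine le_trans (Finset.sum_le_sum (g := fun k : Fin (P.p δ + 1) => 31 / 10 * x *
      (‖lagrangeWeight (P.p δ) k s‖ * ((k : ℝ) + 1) ^ (-P.μ))) fun k _ => ?_) ?_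
    · have hk1 : (1 : ℝ) ≤ ((k : ℕ) : ℝ) + 1 := le_add_of_nonneg_left (Nat.cast_nonneg _)
      have hk := (hray _ hk1 hx100).2.2
      rw [hq _ hk1, ← hκ _ ⟨hk1, node_le _ k⟩] at hk
      have hcast : ((((k : ℕ) : ℝ) + 1 : ℝ) : ℂ) = (k : ℂ) + 1 := by push_cast; rfl
      rw [hcast] at hk
      rw [norm_mul]
      refine (mul_le_mul_of_nonneg_left hk (norm_nonneg _)).trans (le_of_eq ?_)
      ring
    · rw [← Finset.mul_sum, mul_comm A, ← mul_assoc]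
      exact mul_le_mul_of_nonneg_left (hsumA s hs1) (by positivity)
  have hhs : ‖h s‖ ≤ 111 / 10 * (A * x) := by
    have hdec : h s = interpError (P.p δ) h s +
        ∑ k : Fin (P.p δ + 1), lagrangeWeight (P.p δ) k s * h ((k : ℂ) + 1) := by
      rw [interpError]; ring
    rw [hdec]
    refine (norm_add_le _ _).trans ?_
    linarith
  have hqe : g₂ z / g₁ z = exp (h s) := by
    rw [hh, exp_sub, hκ1, div_one, hquot s (by linarith), hzs]
  have hAx : 0 < A * x := mul_pos hA0 hx0
  have hexp := norm_exp_sub_one_sub_id_le (x := h s) (by linarith)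
  have hfin : ‖exp (h s) - 1‖ ≤ ‖h s‖ ^ 2 + ‖h s‖ := by
    have := norm_add_le (exp (h s) - 1 - h s) (h s)
    rw [sub_add_cancel] at this
    linarith
  rw [hqe, mul_assoc]
  nlinarith [norm_nonneg (h s)]

end ClassParams

end

theorem theorem1 (P : ClassParams) (hP : P.Admissible) (δ : ℝ) (hδ : δ ∈ Set.Ioo (0 : ℝ) 1)
    (φ : ℝ) (ψ₁ ψ₂ : ℂ → ℂ) (hψ₁ : P.Mem φ ψ₁) (hψ₂ : P.Mem φ ψ₂)
    (R : ℝ) (hzeros : SameZeros ψ₁ ψ₂ R) :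
    -- `q` is the ratio `ψ₂ / ψ₁`, extended analytically over the common zeros
    ∃ q : ℂ → ℂ, AnalyticOnNhd ℂ q (Metric.ball 0 R) ∧
      (∀ z ∈ Metric.ball (0 : ℂ) R, ψ₁ z ≠ 0 → q z = ψ₂ z / ψ₁ z) ∧
      (∀ ε : ℝ, 0 < ε → ∀ δ₁ ∈ Set.Ioo (0 : ℝ) δ, P.R₀ δ δ₁ ε ≤ R →
        ∀ z ∈ Metric.ball (0 : ℂ) (R ^ (1 - δ)), ‖q z - 1‖ < ε / R ^ (P.μ * (1 - δ))) ∧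
      (P.threshold δ ≤ R →
        ∀ z ∈ Metric.ball (0 : ℂ) (R ^ (1 - δ)), ‖q z - 1‖ ≤ P.C δ / R ^ (P.μ * (1 - δ))) := by
  obtain ⟨Z, m, g₁, g₂, hg₁, hg₂, hZ, hf₁, hf₂, h₁0, h₂0⟩ :=
    hψ₁.exists_common_factor hP hψ₂ hzeros
  refine ⟨fun z => g₂ z / g₁ z, fun z hz => (hg₂.analyticAt z).div (hg₁.analyticAt z) (h₁0 z hz),
    fun z _ hne => ?_, fun ε hε δ₁ hδ₁ hR z hz => ?_, fun hR z hz => ?_⟩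
  · rw [hf₁] at hne
    change g₂ z / g₁ z = ψ₂ z / ψ₁ z
    rw [hf₁, hf₂, mul_div_mul_left _ _ (left_ne_zero_of_mul hne)]
  · -- the constant `C(δ₁)` is absorbed by the gain `R ^ (μ (δ - δ₁))`
    simp only [ClassParams.R₀, ClassParams.R', max_le_iff] at hR
    obtain ⟨-, hR₁, hRε⟩ := hR
    have hμ := hP.μ_pos
    have hδ₁' : δ₁ ∈ Set.Ioo (0 : ℝ) 1 := ⟨hδ₁.1, hδ₁.2.trans hδ.2⟩
    have hR1 : 1 ≤ R := hP.one_le_r₁.trans ((le_max_left _ _).trans hR₁)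
    have hR0 : 0 < R := by linarith
    have hC : 0 ≤ P.C δ₁ := by
      have := A_pos P (ClassParams.p_spec (P := P) hδ₁.1).1
      have := hP.C₁_pos
      rw [ClassParams.C]; positivity
    have hgap : 0 < P.μ * (δ - δ₁) := mul_pos hμ (sub_pos.mpr hδ₁.2)
    have hCε := ClassParams.le_rpow_of_rpow_one_div_le (by positivity) hgap hRε
    have hz₁ : z ∈ Metric.ball (0 : ℂ) (R ^ (1 - δ₁)) := by
      refine Metric.ball_subset_ball (Real.rpow_le_rpow_of_exponent_le hR1 ?_) hz
      linarith [hδ₁.2]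
    refine (hψ₁.norm_div_sub_one_lt hP hδ₁' hψ₂ hR₁ hg₁ hg₂ hZ hf₁ hf₂ h₁0 h₂0 hz₁).trans_le ?_
    rw [div_le_iff₀ hε] at hCε
    have hsplit : R ^ (P.μ * (1 - δ₁)) = R ^ (P.μ * (δ - δ₁)) * R ^ (P.μ * (1 - δ)) := by
      rw [← Real.rpow_add hR0]; congr 1; ring
    rw [hsplit, div_le_div_iff₀ (by positivity) (by positivity)]
    have : 0 < R ^ (P.μ * (1 - δ)) := by positivity
    nlinarith
  · exact (hψ₁.norm_div_sub_one_lt hP hδ hψ₂ hR hg₁ hg₂ hZ hf₁ hf₂ h₁0 h₂0 hz).le
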